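/- **Setting.** Let a fractured porous medium in $\mathbb R^n$ be decomposed into finitely many connected subdomains $\Omega_i$ of dimensions $0\le d_i\le n$ (rock, fractures, intersections), and let an interface $\Gamma_e$ be one side of a lower-dimensional subdomain, lying along $\Omega_{i}$ of dimension $d$ and on the boundary of an adjacent subdomain of dimension $d+1$. The medium is connected through the interfaces, and the Dirichlet boundary has positive measure. Each $\Omega_i$ carries a conforming simplicial mesh and each $\Gamma_e$ its own simplicial mortar mesh; these meshes need not match, except that each $\Gamma_e$ is a union of facets of the mesh of the adjacent $(d+1)$-dimensional subdomain. Let $\mathbf V_h$ be the lowest-order Raviart–Thomas space on the subdomains with zero normal flux on the Neumann boundary (and no flux in points), $\mathbf V_{0h}\subset \mathbf V_h$ the subspace with zero normal flux on all interfaces, $\Lambda_h$ and $Q_h$ the piecewise constants on the mortar meshes and on the subdomain meshes, and $\mathbf W_h=\mathbf V_{0h}\times\Lambda_h$. Let $R_h:\Lambda_h\to\mathbf V_h$ be the extension whose normal component is, on interface facets, the $L^2$-projection of the mortar function onto the normal traces of $\mathbf V_h$, and $0$ on all other facets. The physical parameters are a symmetric positive definite tensor $K$, constant on each subdomain; a normal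 permeability $K_\nu$ bounded above and below by positive constants; and $\gamma>0$, constant on each interface. For $\mathbf w=[\mathbf u_0,\lambda]$, $\mathbf r=[\mathbf v_0,\mu]\in\mathbf W_h$ and $p\in Q_h$ put $$a(\mathbf w,\mathbf r)=(K^{-1}(\mathbf u_0+R_h\lambda),\mathbf v_0+R_h\mu)_\Omega+(\gamma K_\nu^{-1}\lambda,\mu)_\Gamma,\qquad b(\mathbf r,p)=-(p,\nabla\cdot(\mathbf v_0+R_h\mu)+[\![\mu]\!])_\Omega ,$$ where $[\![\mu]\!]$ on a subdomain is minus the sum of $\mu$ over the interfaces lying along it. Let $a^D$ be obtained from $a$ by replacing, on each cell $T$, the product $(K^{-1}\mathbf u,\mathbf v)_T$ by its diagonal part $\sum_{f\subset\partial T}(\mathbf u\cdot\nu_f)(\mathbf v\cdot\nu_f)(K^{-1}\phi_f,\phi_f)_T$, where $\phi_f$ is the Raviart–Thomas basis function of the facet $f$. Let $A,D_A:\mathbf W_h\to\mathbf W_h'$ and $B:\mathbf W_h\to Q_h'$ be the operators of $a$, $a^D$, $b$, and $$\mathcal A=\begin{pmatrix}A&B^T\\-B&0\end{pmatrix},\qquad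 \mathcal B_D=\begin{pmatrix}A&0\\0&BD_A^{-1}B^T\end{pmatrix}^{-1},\qquad \mathcal B_L=\begin{pmatrix}A&0\\-B&BD_A^{-1}B^T\end{pmatrix}^{-1},$$ $(\mathbf x,\mathbf y)_{\mathcal B_D^{-1}}=\langle\mathcal B_D^{-1}\mathbf x,\mathbf y\rangle$ and $\|\mathbf x\|_{\mathcal B_D^{-1}}^2=(\mathbf x,\mathbf x)_{\mathcal B_D^{-1}}$. **Theorem.** The operator $D_A$ and the two block operators inverted above are bijective, and $(\cdot,\cdot)_{\mathcal B_D^{-1}}$ is an inner product on $\mathbf W_h\times Q_h$. If $c_1,c_2>0$ satisfy $$c_1\,a^D(\mathbf r,\mathbf r)\le a(\mathbf r,\mathbf r)\le c_2\,a^D(\mathbf r,\mathbf r)\qquad\text{for all }\mathbf r\in\mathbf W_h,\tag{1}$$ then for every $\mathbf x\in\mathbf W_h\times Q_h$, $\mathbf x\ne 0$, $$\xi_1\le\frac{(\mathcal B_L\mathcal A\mathbf x,\mathbf x)_{\mathcal B_D^{-1}}}{(\mathbf x,\mathbf x)_{\mathcal B_D^{-1}}},\qquad \frac{\|\mathcal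 B_L\mathcal A\mathbf x\|_{\mathcal B_D^{-1}}}{\|\mathbf x\|_{\mathcal B_D^{-1}}}\le\xi_2,\qquad \xi_1=\tfrac12\min\{1,c_2^{-1}\},\quad \xi_2=\max\{2,2c_1^{-1}\}.\tag{2}$$ Moreover, for all $n,\sigma,\kappa$ there are constants $c_1,c_2>0$, depending only on $n,\sigma,\kappa$, such that (1), and hence (2), holds for every such medium, all meshes with shape-regularity constant at most $\sigma$ (each cell $T$ of a subdomain mesh contains a $d_i$-dimensional ball of radius $r$ with $\operatorname{diam}T\le\sigma r$) and all parameters $K,K_\nu,\gamma$ such that on each subdomain the ratio of the largest to the smallest eigenvalue of $K$ is at most $\kappa$. In particular, for isotropic $K$ ($\kappa=1$), $\xi_1$ and $\xi_2$ depend only on $n$ and on the shape regularity of the meshes, so $\mathcal B_L$ is field-of-values equivalent to $\mathcal A$, uniformly in the mesh size and in the physical parameters. -/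

import Mathlib

open MeasureTheory

noncomputable section

namespace MixedDim

/-- The ambient Euclidean space. -/
abbrev E (n : ℕ) : Type := EuclideanSpace ℝ (Fin n)

/-- Role of a facet of a cell of a subdomain mesh. `F` is the type of all facets of that mesh and
`J` the type of interfaces. -/
inductive FacetKind (F J : Type) : Type
  /-- interior facet, identified with a facet of another cell of the same mesh -/
  | glued (G : F)
  /-- facet on the part of the outer boundary where the pressure is prescribed -/
  | dirichlet
  /-- facet on which the normal flux vanishes -/
  | neumann
  /-- facet lying on the interface `e` with a subdomain of one dimension less -/
  | mortar (e : J)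

/-- A fractured porous medium in `ℝⁿ` with its simplicial meshes.

The subdomains `i : Sub` have dimension `dim i` (the rock has dimension `n`, the fractures have
dimension `n - 1`, their intersections lower dimensions). Each one is the union of the simplices of
its own mesh. The cell `T` of subdomain `i` is the convex hull of the `dim i + 1` points
`vert i T k`, and its facet `(T, k)` is the one opposite to the vertex `k`. An interface `e : Ifc`
is one side of the lower dimensional subdomain `lower e`, seen from the subdomain `upper e` of one
dimension more; it has its own mortar mesh. The meshes of `upper e`, of `lower e` and the
mortar mesh need not match. Both sides of a fracture may belong to the same subdomain: they are then
two different interfaces, and the facets on the two sides are not glued. -/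
structure Mesh (n : ℕ) where
  /-- the subdomains, of all dimensions -/
  Sub : Type
  [fintypeSub : Fintype Sub]
  dim : Sub → ℕ
  /-- the cells of the mesh of a subdomain -/
  Cell : Sub → Type
  [fintypeCell : ∀ i, Fintype (Cell i)]
  [nonemptyCell : ∀ i, Nonempty (Cell i)]
  vert : ∀ i, Cell i → Fin (dim i + 1) → E n
  vert_indep : ∀ i T, AffineIndependent ℝ (vert i T)
  /-- different cells overlap in a null set only -/
  cell_nonoverlap : ∀ i T T', T ≠ T' →
    μHE[dim i] (convexHull ℝ (Set.range (vert i T)) ∩ convexHull ℝ (Set.range (vert i T'))) = 0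
  /-- the interfaces, of all dimensions -/
  Ifc : Type
  [fintypeIfc : Fintype Ifc]
  lower : Ifc → Sub
  upper : Ifc → Sub
  dim_upper : ∀ e, dim (upper e) = dim (lower e) + 1
  /-- the cells of the mortar mesh of an interface -/
  MCell : Ifc → Type
  [fintypeMCell : ∀ e, Fintype (MCell e)]
  [nonemptyMCell : ∀ e, Nonempty (MCell e)]
  mvert : ∀ e, MCell e → Fin (dim (lower e) + 1) → E n
  mvert_indep : ∀ e m, AffineIndependent ℝ (mvert e m)
  mcell_nonoverlap : ∀ e m m', m ≠ m' →
    μHE[dim (lower e)]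
      (convexHull ℝ (Set.range (mvert e m)) ∩ convexHull ℝ (Set.range (mvert e m'))) = 0
  /-- the role of each facet -/
  kind : ∀ i, Cell i × Fin (dim i + 1) → FacetKind (Cell i × Fin (dim i + 1)) Ifc
  /-- gluing is symmetric, ... -/
  glued_symm : ∀ i F G, kind i F = .glued G → kind i G = .glued F
  /-- ... joins facets of different cells ... -/
  glued_ne : ∀ i F G, kind i F = .glued G → F.1 ≠ G.1
  /-- ... and only facets with the same vertices: the mesh is conforming -/
  glued_vert : ∀ i F G, kind i F = .glued G →
    vert i F.1 '' {F.2}ᶜ = vert i G.1 '' {G.2}ᶜ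
  /-- there is no flow within a point -/
  kind_point : ∀ i F, dim i = 0 → kind i F = .neumann
  kind_mortar : ∀ i F e, kind i F = .mortar e → upper e = i
  /-- an interface is the union of the facets of the mesh of `upper e` that lie on it ... -/
  mortar_cover : ∀ e,
    (⋃ F ∈ {F | kind (upper e) F = .mortar e},
      convexHull ℝ (vert (upper e) F.1 '' {F.2}ᶜ)) =
    ⋃ m, convexHull ℝ (Set.range (mvert e m))
  /-- ... which do not overlap, ... -/
  mortar_nonoverlap : ∀ e F G, kind (upper e) F = .mortar e → kind (upper e) G = .mortar e →
    F ≠ G → μHE[dim (lower e)]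
      (convexHull ℝ (vert (upper e) F.1 '' {F.2}ᶜ) ∩
        convexHull ℝ (vert (upper e) G.1 '' {G.2}ᶜ)) = 0
  /-- ... and it lies along the subdomain `lower e` -/
  mortar_subset : ∀ e,
    (⋃ m, convexHull ℝ (Set.range (mvert e m))) ⊆
      ⋃ T, convexHull ℝ (Set.range (vert (lower e) T))
  /-- each subdomain is connected (through facets of its mesh) -/
  sub_connected : ∀ i T T',
    Relation.ReflTransGen (fun S S' => ∃ k k', kind i (S, k) = .glued (S', k')) T T'
  /-- the whole medium is connected (through interfaces) -/
  connected : ∀ i j, Relation.EqvGen (fun i j => ∃ e, upper e = i ∧ lower e = j) i j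
  /-- the Dirichlet boundary has positive measure -/
  exists_dirichlet : ∃ i F, kind i F = .dirichlet

attribute [instance] Mesh.fintypeSub Mesh.fintypeCell Mesh.nonemptyCell Mesh.fintypeIfc
  Mesh.fintypeMCell Mesh.nonemptyMCell

namespace Mesh

variable {n : ℕ} (G : Mesh n)

/-- The cell as a subset of `ℝⁿ`. -/
def cellSet (i : G.Sub) (T : G.Cell i) : Set (E n) := convexHull ℝ (Set.range (G.vert i T))

/-- The facet of `T` opposite to its vertex `k`. -/
def facetSet (i : G.Sub) (T : G.Cell i) (k : Fin (G.dim i + 1)) : Set (E n) :=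
  convexHull ℝ (G.vert i T '' {k}ᶜ)

/-- The mortar cell as a subset of `ℝⁿ`. -/
def mcellSet (e : G.Ifc) (m : G.MCell e) : Set (E n) := convexHull ℝ (Set.range (G.mvert e m))

/-- Volume of a cell; `μHE[d]` is the `d`-dimensional Lebesgue (surface) measure in `ℝⁿ`. -/
def cellVol (i : G.Sub) (T : G.Cell i) : ℝ := (μHE[G.dim i] : Measure (E n)).real (G.cellSet i T)

/-- Area of a facet. -/
def facetVol (i : G.Sub) (T : G.Cell i) (k : Fin (G.dim i + 1)) : ℝ :=
  (μHE[G.dim i - 1] : Measure (E n)).real (G.facetSet i T k)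

/-- Every cell `T` contains a ball of its own dimension whose radius `r` satisfies
`diam T ≤ σ r`. -/
def ShapeRegular (σ : ℝ) : Prop :=
  ∀ i T, ∃ c ∈ affineSpan ℝ (Set.range (G.vert i T)), ∃ r > 0,
    Metric.closedBall c r ∩ (affineSpan ℝ (Set.range (G.vert i T)) : Set (E n)) ⊆ G.cellSet i T ∧
    Metric.diam (G.cellSet i T) ≤ σ * r

/-! ### Lowest order Raviart-Thomas functions -/

/-- The coefficient `|f| / (d |T|)` of the Raviart-Thomas basis function of a facet. -/
def rtCoef (i : G.Sub) (T : G.Cell i) (k : Fin (G.dim i + 1)) : ℝ :=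
  G.facetVol i T k / (G.dim i * G.cellVol i T)

/-- The Raviart-Thomas basis function on `T` of the facet `f` opposite to the vertex `x_k`,
`φ(x) = |f| / (d |T|) (x - x_k)`. Its outer normal component is `1` on `f` and `0` on the other
facets of `T`. -/
def rtBasis (i : G.Sub) (T : G.Cell i) (k : Fin (G.dim i + 1)) (x : E n) : E n :=
  G.rtCoef i T k • (x - G.vert i T k)

/-- Elementwise Raviart-Thomas functions on all subdomains, represented by their outer normal
components on the facets: `u` stands for the field `∑ k, u i T k • rtBasis i T k` on each `T`. -/
abbrev Flux : Type := ∀ i, G.Cell i → Fin (G.dim i + 1) → ℝ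

/-- The (constant) divergence on the cell `T` of a Raviart-Thomas function; the divergence of
`x ↦ c (x - x_k)` on a `d`-dimensional cell is `d c`. -/
def divCell (u : G.Flux) (i : G.Sub) (T : G.Cell i) : ℝ :=
  ∑ k, u i T k * (G.dim i * G.rtCoef i T k)

/-- The space `V_h`: the normal component is continuous across interior facets (the outer normals of
the two cells are opposite) and zero on Neumann facets. -/
def Vh : Submodule ℝ G.Flux where
  carrier := {u | (∀ i F F', G.kind i F = .glued F' → u i F.1 F.2 = - u i F'.1 F'.2) ∧
    ∀ i F, G.kind i F = .neumann → u i F.1 F.2 = 0}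
  add_mem' := by
    rintro u v ⟨hu, hu'⟩ ⟨hv, hv'⟩
    refine ⟨fun i F F' h => ?_, fun i F h => ?_⟩
    · simp only [Pi.add_apply, hu i F F' h, hv i F F' h]; ring
    · simp [hu' i F h, hv' i F h]
  zero_mem' := by simp
  smul_mem' := by
    rintro c u ⟨hu, hu'⟩
    refine ⟨fun i F F' h => ?_, fun i F h => ?_⟩
    · simp [hu i F F' h]
    · simp [hu' i F h]

/-- The space `V_{0h}`: in addition the normal component is zero on all interfaces. -/
def V0h : Submodule ℝ G.Flux where
  carrier := {u | u ∈ G.Vh ∧ ∀ i F e, G.kind i F = .mortar e → u i F.1 F.2 = 0}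
  add_mem' := by
    rintro u v ⟨hu, hu'⟩ ⟨hv, hv'⟩
    exact ⟨G.Vh.add_mem hu hv, fun i F e h => by simp [hu' i F e h, hv' i F e h]⟩
  zero_mem' := ⟨G.Vh.zero_mem, by simp⟩
  smul_mem' := by
    rintro c u ⟨hu, hu'⟩
    exact ⟨G.Vh.smul_mem c hu, fun i F e h => by simp [hu' i F e h]⟩

/-- The mortar space `Λ_h` of piecewise constants on the mortar meshes. -/
abbrev Lam : Type := ∀ e, G.MCell e → ℝ

/-- The pressure space `Q_h` of piecewise constants on the meshes of the subdomains. -/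
abbrev Qh : Type := ∀ i, G.Cell i → ℝ

/-- The space `W_h = V_{0h} × Λ_h` of all fluxes. -/
abbrev Wh : Type := G.V0h × G.Lam

/-- The value on the facet `(T, k)` of the `L²` projection of the mortar function `μ` on the
interface `e` onto the normal traces of `V_h`, that is, onto the functions that are constant on each
facet: the mean of `μ` over the facet. -/
def mortarProj (μ : G.Lam) (e : G.Ifc) (i : G.Sub) (T : G.Cell i) (k : Fin (G.dim i + 1)) : ℝ :=
  (∑ m, μ e m * (μHE[G.dim (G.lower e)] : Measure (E n)).real
    (G.facetSet i T k ∩ G.mcellSet e m)) / G.facetVol i T k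

/-- The discrete extension operator `R_h : Λ_h → V_h`: the normal component of `R_h μ` is the
projection of `μ` on the facets on an interface, and zero on all other facets. -/
def Rh : G.Lam →ₗ[ℝ] G.Vh where
  toFun μ := ⟨fun i T k => match G.kind i (T, k) with
      | .mortar e => G.mortarProj μ e i T k
      | _ => 0, by
    refine ⟨fun i F F' h => ?_, fun i F h => ?_⟩
    · have h' := G.glued_symm i F F' h
      simp [h, h']
    · simp [h]⟩
  map_add' μ μ' := by
    ext i T k
    simp only [Submodule.coe_add, Pi.add_apply]
    cases G.kind i (T, k) <;> simp [mortarProj, add_mul, Finset.sum_add_distrib, add_div]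
  map_smul' c μ := by
    ext i T k
    simp only [Submodule.coe_smul, Pi.smul_apply, RingHom.id_apply]
    cases G.kind i (T, k) <;>
      simp [mortarProj, mul_assoc, ← Finset.mul_sum, mul_div_assoc]

/-- The total flux `v₀ + R_h μ` of `[v₀, μ] ∈ W_h`. -/
def total : G.Wh →ₗ[ℝ] G.Flux :=
  G.V0h.subtype ∘ₗ LinearMap.fst ℝ G.V0h G.Lam +
    (G.Vh.subtype ∘ₗ G.Rh) ∘ₗ LinearMap.snd ℝ G.V0h G.Lam

/-- The pairing `(p, D · [v₀ + R_h μ, μ])_Ω = (p, ∇ · (v₀ + R_h μ))_Ω + (p, ⟦μ⟧)_Ω`, where the jump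
`⟦μ⟧` on a subdomain is minus the sum of `μ` over the interfaces `e` with that subdomain as
`lower e`. -/
def divPairing (r : G.Wh) (p : G.Qh) : ℝ :=
  (∑ i, ∑ T, p i T * (G.divCell (G.total r) i T * G.cellVol i T)) +
    ∑ e, ∑ T, ∑ m, p (G.lower e) T * (-(r.2 e m) *
      (μHE[G.dim (G.lower e)] : Measure (E n)).real (G.cellSet (G.lower e) T ∩ G.mcellSet e m))

/-- The operator `B : W_h → Q_h'`, `⟨B r, p⟩ = b(r, p) = -(p, D · [v₀ + R_h μ, μ])_Ω`. -/
def opB : G.Wh →ₗ[ℝ] Module.Dual ℝ G.Qh :=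
  LinearMap.mk₂ ℝ (fun r p => - G.divPairing r p)
    (by
      intro r r' p
      simp only [divPairing, divCell, map_add, Pi.add_apply, Prod.snd_add, add_mul, neg_add,
        mul_add, Finset.sum_add_distrib]
      ring)
    (by
      intro c r p
      simp only [divPairing, divCell, map_smul, Pi.smul_apply, Prod.smul_snd, smul_eq_mul,
        Finset.mul_sum, Finset.sum_mul, mul_neg, mul_add]
      congr 2 <;> (repeat' (refine Finset.sum_congr rfl fun _ _ => ?_)) <;> ring)
    (by
      intro r p p'
      simp only [divPairing, Pi.add_apply, add_mul, neg_add, Finset.sum_add_distrib]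
      ring)
    (by
      intro c r p
      simp only [divPairing, Pi.smul_apply, smul_eq_mul, Finset.mul_sum, mul_neg, mul_add]
      congr 2 <;> (repeat' (refine Finset.sum_congr rfl fun _ _ => ?_)) <;> ring)

/-- The transposed operator `Bᵀ : Q_h → W_h'`. -/
def opBT : G.Qh →ₗ[ℝ] Module.Dual ℝ G.Wh := G.opB.flip

end Mesh

/-- The physical parameters: a symmetric positive definite permeability tensor `K i`, constant on
each subdomain (only its inverse on tangent vectors enters); a normal permeability `Kν e`, bounded
above and below by positive constants; a positive constant aperture `γ e` on each interface. -/
structure Params {n : ℕ} (G : Mesh n) where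
  K : G.Sub → Matrix (Fin n) (Fin n) ℝ
  K_posDef : ∀ i, (K i).PosDef
  Kν : G.Ifc → E n → ℝ
  Kν_measurable : ∀ e, Measurable (Kν e)
  Kν_bounds : ∀ e, ∃ a b : ℝ, 0 < a ∧ ∀ x, a ≤ Kν e x ∧ Kν e x ≤ b
  γ : G.Ifc → ℝ
  γ_pos : ∀ e, 0 < γ e

/-- The inverse of a bijective linear map (and `0` if the map is not bijective). -/
def invOp {X Y : Type*} [AddCommGroup X] [Module ℝ X] [AddCommGroup Y] [Module ℝ Y]
    (f : X →ₗ[ℝ] Y) : Y →ₗ[ℝ] X :=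
  open Classical in
  if h : Function.Bijective f then ((LinearEquiv.ofBijective f h).symm : Y →ₗ[ℝ] X) else 0

namespace Params

variable {n : ℕ} {G : Mesh n} (P : Params G)

/-- On each subdomain the ratio of the largest to the smallest eigenvalue of `K` is at most `κ`. For
isotropic permeabilities this holds with `κ = 1`. -/
def AnisotropyLE (κ : ℝ) : Prop :=
  ∀ i (ξ η : E n), inner ℝ ξ (Matrix.toEuclideanLin (P.K i) ξ) * ‖η‖ ^ 2 ≤
    κ * (inner ℝ η (Matrix.toEuclideanLin (P.K i) η) * ‖ξ‖ ^ 2)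

/-- The local matrix entry `(K⁻¹ φ_k, φ_l)_T`. -/
def mass (i : G.Sub) (T : G.Cell i) (k l : Fin (G.dim i + 1)) : ℝ :=
  ∫ x in G.cellSet i T,
    inner ℝ (Matrix.toEuclideanLin (P.K i)⁻¹ (G.rtBasis i T k x)) (G.rtBasis i T l x) ∂μHE[G.dim i]

/-- The form `(K⁻¹ u, v)_Ω` on Raviart-Thomas functions. -/
def fluxForm : G.Flux →ₗ[ℝ] G.Flux →ₗ[ℝ] ℝ :=
  LinearMap.mk₂ ℝ (fun u v => ∑ i, ∑ T, ∑ k, ∑ l, u i T k * v i T l * P.mass i T k l)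
    (by intro u u' v; simp [add_mul, Finset.sum_add_distrib])
    (by intro c u v; simp [Finset.mul_sum, mul_assoc])
    (by intro u v v'; simp [add_mul, mul_add, Finset.sum_add_distrib])
    (by intro c u v; simp [Finset.mul_sum, mul_assoc, mul_left_comm])

/-- The form `(K⁻¹ u, v)_{D,Ω}`: only the diagonal entries of the local matrices are kept. -/
def fluxFormD : G.Flux →ₗ[ℝ] G.Flux →ₗ[ℝ] ℝ :=
  LinearMap.mk₂ ℝ (fun u v => ∑ i, ∑ T, ∑ k, u i T k * v i T k * P.mass i T k k)
    (by intro u u' v; simp [add_mul, Finset.sum_add_distrib])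
    (by intro c u v; simp [Finset.mul_sum, mul_assoc])
    (by intro u v v'; simp [add_mul, mul_add, Finset.sum_add_distrib])
    (by intro c u v; simp [Finset.mul_sum, mul_assoc, mul_left_comm])

/-- The form `(γ Kν⁻¹ λ, μ)_Γ` on mortar functions. -/
def mortarForm : G.Lam →ₗ[ℝ] G.Lam →ₗ[ℝ] ℝ :=
  LinearMap.mk₂ ℝ (fun lam μ => ∑ e, ∑ m, lam e m * μ e m *
      ∫ x in G.mcellSet e m, P.γ e * (P.Kν e x)⁻¹ ∂μHE[G.dim (G.lower e)])
    (by intro u u' v; simp [add_mul, Finset.sum_add_distrib])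
    (by intro c u v; simp [Finset.mul_sum, mul_assoc])
    (by intro u v v'; simp [add_mul, mul_add, Finset.sum_add_distrib])
    (by intro c u v; simp [Finset.mul_sum, mul_assoc, mul_left_comm])

/-- The operator `A : W_h → W_h'`,
`⟨A w, r⟩ = a(w, r) = (K⁻¹ (u₀ + R_h λ), v₀ + R_h μ)_Ω + (γ Kν⁻¹ λ, μ)_Γ`. -/
def opA : G.Wh →ₗ[ℝ] Module.Dual ℝ G.Wh :=
  P.fluxForm.compl₁₂ G.total G.total +
    P.mortarForm.compl₁₂ (LinearMap.snd ℝ G.V0h G.Lam) (LinearMap.snd ℝ G.V0h G.Lam)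

/-- The operator `D_A : W_h → W_h'`,
`⟨D_A w, r⟩ = a^D(w, r) = (K⁻¹ (u₀ + R_h λ), v₀ + R_h μ)_{D,Ω} + (γ Kν⁻¹ λ, μ)_Γ`. -/
def opDA : G.Wh →ₗ[ℝ] Module.Dual ℝ G.Wh :=
  P.fluxFormD.compl₁₂ G.total G.total +
    P.mortarForm.compl₁₂ (LinearMap.snd ℝ G.V0h G.Lam) (LinearMap.snd ℝ G.V0h G.Lam)

/-- `B D_A⁻¹ Bᵀ : Q_h → Q_h'`. -/
def schur : G.Qh →ₗ[ℝ] Module.Dual ℝ G.Qh := G.opB ∘ₗ invOp P.opDA ∘ₗ G.opBT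

/-- The block operator `𝒜 = [[A, Bᵀ], [-B, 0]]` from `X = W_h × Q_h` to `X' = W_h' × Q_h'`. -/
def opCalA : G.Wh × G.Qh →ₗ[ℝ] Module.Dual ℝ G.Wh × Module.Dual ℝ G.Qh :=
  (P.opA ∘ₗ LinearMap.fst ℝ G.Wh G.Qh + G.opBT ∘ₗ LinearMap.snd ℝ G.Wh G.Qh).prod
    (-(G.opB ∘ₗ LinearMap.fst ℝ G.Wh G.Qh))

/-- The block operator `[[A, 0], [0, B D_A⁻¹ Bᵀ]]`, the inverse of the preconditioner `ℬ_D`. -/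
def blockD : G.Wh × G.Qh →ₗ[ℝ] Module.Dual ℝ G.Wh × Module.Dual ℝ G.Qh :=
  (P.opA ∘ₗ LinearMap.fst ℝ G.Wh G.Qh).prod (P.schur ∘ₗ LinearMap.snd ℝ G.Wh G.Qh)

/-- The block operator `[[A, 0], [-B, B D_A⁻¹ Bᵀ]]`. -/
def blockL : G.Wh × G.Qh →ₗ[ℝ] Module.Dual ℝ G.Wh × Module.Dual ℝ G.Qh :=
  (P.opA ∘ₗ LinearMap.fst ℝ G.Wh G.Qh).prod
    (-(G.opB ∘ₗ LinearMap.fst ℝ G.Wh G.Qh) + P.schur ∘ₗ LinearMap.snd ℝ G.Wh G.Qh)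

/-- The exact block lower triangular preconditioner `ℬ_L = [[A, 0], [-B, B D_A⁻¹ Bᵀ]]⁻¹`. -/
def precondL : Module.Dual ℝ G.Wh × Module.Dual ℝ G.Qh →ₗ[ℝ] G.Wh × G.Qh := invOp P.blockL

/-- `(x, y)_{ℬ_D⁻¹} = ⟨ℬ_D⁻¹ x, y⟩`. -/
def innerBD (x y : G.Wh × G.Qh) : ℝ := (P.blockD x).1 y.1 + (P.blockD x).2 y.2

/-- `‖x‖_{ℬ_D⁻¹}`. -/
def normBD (x : G.Wh × G.Qh) : ℝ := Real.sqrt (P.innerBD x x)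

/-- The inverses of `D_A` and of the two block operators exist, and `(·, ·)_{ℬ_D⁻¹}` is an inner
product. -/
def WellDefined : Prop :=
  Function.Bijective P.opDA ∧ Function.Bijective P.blockD ∧ Function.Bijective P.blockL ∧
    (∀ x y, P.innerBD x y = P.innerBD y x) ∧ ∀ x, x ≠ 0 → 0 < P.innerBD x x

/-- The forms `a` and `a^D` are spectrally equivalent with constants `c₁` and `c₂`:
`c₁ ‖r‖²_{a^D} ≤ ‖r‖²_a ≤ c₂ ‖r‖²_{a^D}`. -/
def SpectrallyEquivalent (c₁ c₂ : ℝ) : Prop :=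
  ∀ r, c₁ * P.opDA r r ≤ P.opA r r ∧ P.opA r r ≤ c₂ * P.opDA r r

/-- The two field-of-values bounds for `ℬ_L 𝒜` in the `ℬ_D⁻¹` inner product. -/
def FOVBounds (ξ₁ ξ₂ : ℝ) : Prop :=
  ∀ x : G.Wh × G.Qh, x ≠ 0 →
    ξ₁ ≤ P.innerBD (P.precondL (P.opCalA x)) x / P.innerBD x x ∧
    P.normBD (P.precondL (P.opCalA x)) / P.normBD x ≤ ξ₂

end Params

end MixedDim

end

/-! Write `S` for `B D_A⁻¹ Bᵀ`. Solving the block rows shows that `ℬ_L 𝒜` maps `(w, p)` to `(z, q)`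
with `z = w + a`, `A a = Bᵀ p` and `S q = B a`. The field-of-values bounds are therefore abstract
linear algebra. Inverting `c₁ D_A ≤ A ≤ c₂ D_A` reverses the order, so `c₁ B A⁻¹ Bᵀ ≤ S ≤ c₂ B A⁻¹
Bᵀ`. The quantity `⟨B a, p⟩ = A a a` is thus comparable with `S p p`, and Young's inequality and
Cauchy–Schwarz finish (`fov_lower`, `fov_upper`).

This needs `A` and `D_A` positive definite and `Bᵀ` injective. For injectivity, a pressure
annihilated by every flux is tested against unit fluxes through single facets and against single
mortar cells. It has no jump across interior facets or interfaces and vanishes at a Dirichlet facet,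
so connectedness makes it zero (`opBT_injective`).

The spectral equivalence is local, since `a` and `a^D` share the mortar term and differ only in the
cell matrices. The upper bound is Cauchy–Schwarz over the at most `n + 1` facets of a cell. For the
lower bound, the differential of the barycentric coordinate `λ_k` sends `∑ a_j (x - x_j)` to `s λ_k
- a_k` with `s = ∑ a_j`, and the square of such a function has integral at least a fixed multiple of
`a_k² |T|`, whatever `s` is. An inscribed ball bounds the differential by `1 / r`, while `|x - x_k|
≤ σ r` bounds the diagonal entries; the tensor costs a factor `κ` in each of the two comparisons
(`localMass_diag_le`). -/

namespace MixedDim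

/-! ### Symmetric positive definite operators and abstract field-of-values bounds. -/

section LinearAlgebra

variable {X Y : Type*} [AddCommGroup X] [Module ℝ X] [AddCommGroup Y] [Module ℝ Y]

/-- A linear map to the dual that is symmetric and positive definite. -/
structure SymmPosDef (A : X →ₗ[ℝ] Module.Dual ℝ X) : Prop where
  symm : ∀ x y, A x y = A y x
  pos : ∀ x, x ≠ 0 → 0 < A x x

namespace SymmPosDef

variable {A : X →ₗ[ℝ] Module.Dual ℝ X}

lemma nonneg (hA : SymmPosDef A) (x : X) : 0 ≤ A x x := by
  by_cases h : x = 0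
  · simp [h]
  · exact (hA.pos x h).le

lemma sq_le (hA : SymmPosDef A) (x y : X) : A x y ^ 2 ≤ A x x * A y y := by
  have h := LinearMap.BilinForm.apply_mul_apply_le_of_forall_zero_le A hA.nonneg x y
  rwa [hA.symm y x, ← sq] at h

lemma bijective [FiniteDimensional ℝ X] (hA : SymmPosDef A) : Function.Bijective A := by
  have hinj : Function.Injective A := by
    rw [← LinearMap.ker_eq_bot, LinearMap.ker_eq_bot']
    intro x hx
    by_contra h
    exact (hA.pos x h).ne' (by simp [hx])
  exact ⟨hinj, (LinearMap.injective_iff_surjective_of_finrank_eq_finrank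
    (Subspace.dual_finrank_eq (K := ℝ) (V := X)).symm).1 hinj⟩

end SymmPosDef

lemma apply_invOp {f : X →ₗ[ℝ] Y} (hf : Function.Bijective f) (y : Y) : f (invOp f y) = y := by
  rw [invOp, dif_pos hf]
  exact (LinearEquiv.ofBijective f hf).apply_symm_apply y

variable {A D : X →ₗ[ℝ] Module.Dual ℝ X} {B : X →ₗ[ℝ] Module.Dual ℝ Y}

/-- The Schur complement `B A⁻¹ Bᵀ` is symmetric positive definite if `Bᵀ` is injective. -/
lemma SymmPosDef.schur [FiniteDimensional ℝ X] (hA : SymmPosDef A)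
    (hB : ∀ p, B.flip p = 0 → p = 0) : SymmPosDef (B ∘ₗ invOp A ∘ₗ B.flip) := by
  have key : ∀ p q, (B ∘ₗ invOp A ∘ₗ B.flip) p q =
      A (invOp A (B.flip q)) (invOp A (B.flip p)) := by
    intro p q
    rw [apply_invOp hA.bijective]
    rfl
  refine ⟨fun p q => ?_, fun p hp => ?_⟩
  · rw [key, key, hA.symm]
  · rw [key]
    refine hA.pos _ fun h => hp (hB p ?_)
    rw [← apply_invOp hA.bijective (B.flip p), h, map_zero]

/-- If `c D ≤ A` as quadratic forms then `c f(A⁻¹ f) ≤ f(D⁻¹ f)`. -/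
lemma dual_form_le (hA : SymmPosDef A) (hD : SymmPosDef D) {c : ℝ} (hc : 0 ≤ c)
    (h : ∀ x, c * D x x ≤ A x x) {f : Module.Dual ℝ X} {w z : X} (hw : A w = f) (hz : D z = f) :
    c * f w ≤ f z := by
  -- Cauchy–Schwarz for `D`, as `f w = D z w`. Then `c (A w w)² ≤ D z z * (c * D w w) ≤ D z z * A w
  -- w`, and one factor `A w w` cancels.
  have h1 : f w ^ 2 ≤ D z z * D w w := by rw [← hz]; exact hD.sq_le z w
  have h2 : f w = A w w := by rw [hw]
  have h3 : f z = D z z := by rw [hz]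
  have h4 := h w
  have h5 := hA.nonneg w
  have h6 := hD.nonneg z
  rcases h5.eq_or_lt with h0 | h0
  · rw [h2, ← h0, h3]; simpa using h6
  · rw [h2] at h1 ⊢
    rw [h3]
    have : c * A w w ^ 2 ≤ D z z * A w w := by nlinarith
    nlinarith

/-- The block triangular preconditioner in terms of the solution `z`, `q` of the two block rows:
lower bound of the field of values. -/
lemma fov_lower (hA : SymmPosDef A) {S : Y →ₗ[ℝ] Module.Dual ℝ Y} {c₂ : ℝ}
    (hc₂ : 0 < c₂) (hS : SymmPosDef S) {w z a : X} {p q : Y}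
    (ha : A a = B.flip p) (hz : z = w + a) (hq : S q = B a)
    (hupper : S p p ≤ c₂ * B a p) :
    1 / 2 * min 1 c₂⁻¹ * (A w w + S p p) ≤ A z w + S q p := by
  have h1 : A z w = A w w + A a w := by rw [hz]; simp
  have h2 : A a a = B a p := by rw [ha]; rfl
  have h3 : S q p = A a a := by rw [hq, h2]
  -- Gives `A a w ≥ -(A w w + A a a) / 2`: the cross term consumes half of the diagonal, hence the
  -- factor `1 / 2`.
  have h4 := hA.nonneg (w + a)
  simp only [map_add, LinearMap.add_apply] at h4
  rw [hA.symm w a] at h4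
  have h5 : c₂⁻¹ * S p p ≤ A a a := by
    rw [inv_mul_le_iff₀ hc₂, h2]; exact hupper
  have h6 := mul_le_mul_of_nonneg_right (min_le_left 1 c₂⁻¹) (hA.nonneg w)
  have h7 := mul_le_mul_of_nonneg_right (min_le_right 1 c₂⁻¹) (hS.nonneg p)
  rw [h1, h3]
  nlinarith

/-- The block triangular preconditioner in terms of the solution `z`, `q` of the two block rows:
upper bound of the norm. -/
lemma fov_upper (hA : SymmPosDef A) {S : Y →ₗ[ℝ] Module.Dual ℝ Y} {c₁ : ℝ} (hc₁ : 0 < c₁)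
    (hS : SymmPosDef S) {w z a : X} {p q : Y} (ha : A a = B.flip p) (hz : z = w + a)
    (hq : S q = B a) (hlower : ∀ p a, A a = B.flip p → c₁ * B a p ≤ S p p)
    (hex : ∃ b, A b = B.flip q) :
    A z z + S q q ≤ (max 2 (2 * c₁⁻¹)) ^ 2 * (A w w + S p p) := by
  obtain ⟨b, hb⟩ := hex
  have hAw := hA.nonneg w
  have hSp := hS.nonneg p
  have hSq := hS.nonneg q
  have h1 : A a a ≤ c₁⁻¹ * S p p := by
    have : A a a = B a p := by rw [ha]; rfl
    rw [this, le_inv_mul_iff₀ hc₁]; exact hlower p a ha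
  have h2 : A b b ≤ c₁⁻¹ * S q q := by
    have : A b b = B b q := by rw [hb]; rfl
    rw [this, le_inv_mul_iff₀ hc₁]; exact hlower q b hb
  -- With `b = A⁻¹ Bᵀ q`, Cauchy–Schwarz for `A` bounds `(S q q)²` by `c₁⁻² (S p p) (S q q)`.
  have h3 : S q q = A a b := by
    have : A b a = B a q := by rw [hb]; rfl
    rw [hq, ← this, hA.symm]
  have hA1 : A z z ≤ 2 * A w w + 2 * A a a := by
    have h4 := hA.nonneg (w - a)
    simp only [map_sub, LinearMap.sub_apply] at h4
    rw [hz]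
    simp only [map_add, LinearMap.add_apply]
    linarith
  have hc : 0 < c₁⁻¹ := inv_pos.2 hc₁
  have h5 : S q q ≤ c₁⁻¹ ^ 2 * S p p := by
    rcases hSq.eq_or_lt with h0 | h0
    · rw [← h0]; positivity
    · have h6 : S q q ^ 2 ≤ A a a * A b b := by
        have := hA.sq_le a b
        rwa [← h3] at this
      have h7 : A a a * A b b ≤ (c₁⁻¹ * S p p) * (c₁⁻¹ * S q q) :=
        mul_le_mul h1 h2 (hA.nonneg b) (by positivity)
      have h8 : S q q * S q q ≤ (c₁⁻¹ ^ 2 * S p p) * S q q := by nlinarith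
      exact le_of_mul_le_mul_right h8 h0
  set m := max 2 (2 * c₁⁻¹)
  have hm2 : 2 ≤ m := le_max_left _ _
  have hmc : 2 * c₁⁻¹ ≤ m := le_max_right _ _
  have hmm : 4 ≤ m ^ 2 := by nlinarith
  -- The two terms are at most `m² / 2` and `m² / 4`.
  have hm' : 2 * c₁⁻¹ + c₁⁻¹ ^ 2 ≤ m ^ 2 := by nlinarith
  nlinarith [mul_le_mul_of_nonneg_right hmm hAw, mul_le_mul_of_nonneg_right hm' hSp]

end LinearAlgebra

/-! ### Reduction to definiteness of `A`, `D_A` and injectivity of `Bᵀ`. -/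

namespace Params

variable {n : ℕ} {G : Mesh n} (P : Params G)

/-- Both block operators are block triangular with the definite diagonal blocks `A` and `B D_A⁻¹
Bᵀ`, so forward substitution inverts them. -/
lemma wellDefined_of_symmPosDef (hA : SymmPosDef P.opA) (hD : SymmPosDef P.opDA)
    (hB : ∀ p, G.opBT p = 0 → p = 0) : P.WellDefined := by
  have hS : SymmPosDef P.schur := hD.schur hB
  refine ⟨hD.bijective, ⟨?_, ?_⟩, ⟨?_, ?_⟩, ?_, ?_⟩
  · rintro ⟨w, p⟩ ⟨w', p'⟩ h
    obtain ⟨h1, h2⟩ := Prod.ext_iff.1 h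
    exact Prod.ext (hA.bijective.1 h1) (hS.bijective.1 h2)
  · rintro ⟨f, g⟩
    obtain ⟨w, hw⟩ := hA.bijective.2 f
    obtain ⟨p, hp⟩ := hS.bijective.2 g
    exact ⟨(w, p), Prod.ext hw hp⟩
  · rintro ⟨w, p⟩ ⟨w', p'⟩ h
    obtain ⟨h1, h2⟩ := Prod.ext_iff.1 h
    have hw : w = w' := hA.bijective.1 h1
    subst hw
    exact Prod.ext rfl (hS.bijective.1 (add_left_cancel h2))
  · rintro ⟨f, g⟩
    obtain ⟨w, hw⟩ := hA.bijective.2 f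
    obtain ⟨p, hp⟩ := hS.bijective.2 (g + G.opB w)
    refine ⟨(w, p), Prod.ext hw ?_⟩
    change -(G.opB w) + P.schur p = g
    rw [hp]; abel
  · intro x y
    exact congrArg₂ (· + ·) (hA.symm _ _) (hS.symm _ _)
  · rintro ⟨w, p⟩ h
    change 0 < P.opA w w + P.schur p p
    by_cases hw : w = 0
    · have hp : p ≠ 0 := fun hp => h (by rw [hw, hp]; rfl)
      exact add_pos_of_nonneg_of_pos (hA.nonneg w) (hS.pos p hp)
    · exact add_pos_of_pos_of_nonneg (hA.pos w hw) (hS.nonneg p)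

lemma fovBounds_of_spectrallyEquivalent (hA : SymmPosDef P.opA) (hD : SymmPosDef P.opDA)
    (hB : ∀ p, G.opBT p = 0 → p = 0) {c₁ c₂ : ℝ} (hc₁ : 0 < c₁) (hc₂ : 0 < c₂)
    (h : P.SpectrallyEquivalent c₁ c₂) :
    P.FOVBounds (1 / 2 * min 1 c₂⁻¹) (max 2 (2 * c₁⁻¹)) := by
  have hS : SymmPosDef P.schur := hD.schur hB
  obtain ⟨-, -, hL, -, hpos⟩ := P.wellDefined_of_symmPosDef hA hD hB
  have hSapply : ∀ p, P.schur p p = G.opBT p (invOp P.opDA (G.opBT p)) := fun p => rfl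
  -- Inversion reverses the order of forms; evaluated at functionals `Bᵀ p`, this compares `B A⁻¹
  -- Bᵀ` with the Schur complement of `D_A`.
  have hlow : ∀ p a, P.opA a = G.opBT p → c₁ * G.opB a p ≤ P.schur p p := fun p a ha =>
    dual_form_le hA hD hc₁.le (fun r => (h r).1) ha (apply_invOp hD.bijective _)
  have hupp : ∀ p a, P.opA a = G.opBT p → P.schur p p ≤ c₂ * G.opB a p := fun p a ha => by
    have := dual_form_le hD hA (c := c₂⁻¹) (inv_pos.2 hc₂).le
      (fun r => by rw [inv_mul_le_iff₀ hc₂]; exact (h r).2) (apply_invOp hD.bijective _) ha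
    rwa [inv_mul_le_iff₀ hc₂] at this
  rintro ⟨w, p⟩ hx
  obtain ⟨⟨z, q⟩, hy⟩ : ∃ y, P.precondL (P.opCalA (w, p)) = y := ⟨_, rfl⟩
  have hy' : P.blockL (z, q) = P.opCalA (w, p) := by rw [← hy]; exact apply_invOp hL _
  obtain ⟨h1, h2⟩ := Prod.ext_iff.1 hy'
  change P.opA z = P.opA w + G.opBT p at h1
  change -(G.opB z) + P.schur q = -(G.opB w) at h2
  obtain ⟨a, ha⟩ := hA.bijective.2 (G.opBT p)
  have hz : z = w + a := hA.bijective.1 (by rw [h1, map_add, ha])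
  have hq : P.schur q = G.opB a := by
    rw [hz, map_add] at h2
    have : P.schur q = -(G.opB w) + (G.opB w + G.opB a) := by rw [← h2]; abel
    rw [this]; abel
  have hx' := hpos _ hx
  rw [hy]
  constructor
  · rw [le_div_iff₀ hx']
    exact fov_lower hA hc₂ hS ha hz hq (hupp p a ha)
  · rw [normBD, normBD, div_le_iff₀ (Real.sqrt_pos.2 hx')]
    refine Real.sqrt_le_iff.2 ⟨by positivity, ?_⟩
    rw [mul_pow, Real.sq_sqrt hx'.le]
    exact fov_upper hA hc₁ hS ha hz hq hlow (hA.bijective.2 _)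

end Params

/-! ### Barycentric coordinates and integrals on a simplex in `ℝⁿ`. -/

section Simplex

variable {n d : ℕ} {v : Fin (d + 1) → E n}

lemma isCompact_simplex {ι : Type*} [Finite ι] (v : ι → E n) :
    IsCompact (convexHull ℝ (Set.range v)) := (Set.finite_range v).isCompact_convexHull ℝ

/-- A nondegenerate `d`-dimensional simplex has positive and finite `d`-dimensional measure. -/
lemma simplex_measure (hv : AffineIndependent ℝ v) :
    (μHE[d] : Measure (E n)) (convexHull ℝ (Set.range v)) ≠ 0 ∧
      (μHE[d] : Measure (E n)) (convexHull ℝ (Set.range v)) ≠ ⊤ := by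
  have hdim : Module.finrank ℝ (vectorSpan ℝ (Set.range v)) = d :=
    hv.finrank_vectorSpan (by simp)
  -- With `d` replaced by the dimension of the direction space `V`, an isometric copy of the simplex
  -- lies in `V` and has nonempty interior there.
  generalize hV : vectorSpan ℝ (Set.range v) = V at hdim
  subst hdim
  have hmem : ∀ i, v i - v 0 ∈ V := fun i => by
    refine hV.le ?_
    exact vsub_mem_vectorSpan ℝ (Set.mem_range_self i) (Set.mem_range_self 0)
  let w : Fin (Module.finrank ℝ V + 1) → V := fun i => ⟨v i - v 0, hmem i⟩
  let f : V →ᵃ[ℝ] E n := V.subtype.toAffineMap + AffineMap.const ℝ V (v 0)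
  have hf : ∀ x, f x = (x : E n) + v 0 := fun x => rfl
  have hiso : Isometry f := Isometry.of_dist_eq fun x y => by
    rw [hf, hf, dist_add_right]; rfl
  have hfw : f ∘ w = v := by
    funext i
    simp [hf, w]
  have hwi : AffineIndependent ℝ w := by
    rw [← f.affineIndependent_iff hiso.injective, hfw]; exact hv
  have hspan : affineSpan ℝ (Set.range w) = ⊤ :=
    hwi.affineSpan_eq_top_iff_card_eq_finrank_add_one.2 (by simp)
  have himg : convexHull ℝ (Set.range v) = f '' convexHull ℝ (Set.range w) := by
    rw [f.image_convexHull, ← Set.range_comp, hfw]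
  rw [himg, hiso.euclideanHausdorffMeasure_image]
  constructor
  · have hne := interior_convexHull_nonempty_iff_affineSpan_eq_top.2 hspan
    exact (Measure.measure_pos_of_nonempty_interior _ hne).ne'
  · exact ((Set.finite_range w).isCompact_convexHull ℝ).measure_ne_top

lemma simplex_measureReal_pos (hv : AffineIndependent ℝ v) :
    0 < (μHE[d] : Measure (E n)).real (convexHull ℝ (Set.range v)) :=
  ENNReal.toReal_pos (simplex_measure hv).1 (simplex_measure hv).2

lemma integrableOn_simplex {F : Type*} [NormedAddCommGroup F] [SecondCountableTopology F]
    (hv : AffineIndependent ℝ v) {f : E n → F} (hf : Continuous f) :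
    IntegrableOn f (convexHull ℝ (Set.range v)) (μHE[d] : Measure (E n)) := by
  borelize F
  obtain ⟨C, hC⟩ := (isCompact_simplex v).exists_bound_of_continuousOn hf.continuousOn
  exact Measure.integrableOn_of_bounded (simplex_measure hv).2 hf.aestronglyMeasurable
    ((ae_restrict_iff' (isCompact_simplex v).measurableSet).2 (Filter.Eventually.of_forall hC))

/-- The differential of the barycentric coordinate of the vertex `k`, as a functional on `ℝⁿ`. -/
lemma exists_barycentric (hv : AffineIndependent ℝ v) (k : Fin (d + 1)) :
    ∃ l : E n →ₗ[ℝ] ℝ, ∀ j, j ≠ k → l (v j - v k) = -1 := by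
  have hli := (affineIndependent_iff_linearIndependent_vsub ℝ v k).1 hv
  obtain ⟨l, hl⟩ := LinearMap.exists_extend ((Module.Basis.span hli).constr ℝ fun _ => (-1 : ℝ))
  refine ⟨l, fun j hj => ?_⟩
  have h1 := LinearMap.congr_fun hl (Module.Basis.span hli ⟨j, hj⟩)
  rw [Module.Basis.constr_basis] at h1
  rw [← h1]
  simp [Module.Basis.span_apply]

variable {k : Fin (d + 1)} {l : E n →ₗ[ℝ] ℝ}

/-- The barycentric coordinate is `λ_k(x) = 1 + l (x - v k)`, with values in `[0, 1]` on the
simplex. -/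
lemma barycentric_mem (hl : ∀ j, j ≠ k → l (v j - v k) = -1) {x : E n}
    (hx : x ∈ convexHull ℝ (Set.range v)) : -1 ≤ l (x - v k) ∧ l (x - v k) ≤ 0 := by
  have hsub : convexHull ℝ (Set.range v) ⊆ l ⁻¹' Set.Icc (l (v k) - 1) (l (v k)) := by
    refine convexHull_min ?_ ((convex_Icc _ _).linear_preimage l)
    rintro _ ⟨j, rfl⟩
    by_cases hj : j = k
    · subst hj; simp
    · have := hl j hj
      rw [map_sub] at this
      constructor <;> linarith
  obtain ⟨h1, h2⟩ := hsub hx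
  rw [map_sub]
  constructor <;> linarith

lemma homothety_image_subset {s : Set (E n)} (hs : Convex ℝ s) {c : E n} (hc : c ∈ s) {t : ℝ}
    (h0 : 0 ≤ t) (h1 : t ≤ 1) : AffineMap.homothety c t '' s ⊆ s := by
  rintro _ ⟨x, hx, rfl⟩
  rw [AffineMap.homothety_eq_lineMap]
  exact hs.lineMap_mem hc hx ⟨h0, h1⟩

/-- The functions `a - s λ_k`, with `λ_k` a barycentric coordinate. -/
lemma integral_barycentric (hd : 1 ≤ d) (hv : AffineIndependent ℝ v)
    (hl : ∀ j, j ≠ k → l (v j - v k) = -1) (a s : ℝ) :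
    a ^ 2 / (4 * 8 ^ d) * (μHE[d] : Measure (E n)).real (convexHull ℝ (Set.range v)) ≤
      ∫ x in convexHull ℝ (Set.range v), (s * (1 + l (x - v k)) - a) ^ 2 ∂μHE[d] := by
  set T := convexHull ℝ (Set.range v) with hT
  have hmem : ∀ j, v j ∈ T := fun j => subset_convexHull ℝ _ (Set.mem_range_self j)
  have hlc : Continuous l := l.continuous_of_finiteDimensional
  have hcont : Continuous fun x => (s * (1 + l (x - v k)) - a) ^ 2 := by fun_prop
  have hint := integrableOn_simplex hv hcont
  -- It suffices to have `|s λ_k - a| ≥ |a| / 2` on a copy of the simplex shrunk towards a vertex by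
  -- a ratio `t ≥ 1 / 8`; its measure is at least `8⁻ᵈ` times that of the simplex.
  have key : ∀ (j : Fin (d + 1)) (t : ℝ), 1 / 8 ≤ t → t ≤ 1 →
      (∀ x ∈ T, a ^ 2 / 4 ≤
        (s * (1 + l (AffineMap.homothety (v j) t x - v k)) - a) ^ 2) →
      a ^ 2 / (4 * 8 ^ d) * (μHE[d] : Measure (E n)).real T ≤
        ∫ x in T, (s * (1 + l (x - v k)) - a) ^ 2 ∂μHE[d] := by
    intro j t ht ht1 hbd
    have hsub : AffineMap.homothety (v j) t '' T ⊆ T :=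
      homothety_image_subset (convex_convexHull ℝ _) (hmem j) (by linarith) ht1
    have hmeas : (μHE[d] : Measure (E n)).real (AffineMap.homothety (v j) t '' T) =
        t ^ d * (μHE[d] : Measure (E n)).real T := by
      rw [measureReal_def, euclideanHausdorffMeasure_homothety_image d (v j) (by linarith),
        ENNReal.smul_def, smul_eq_mul, ENNReal.toReal_mul]
      simp [abs_of_nonneg (show (0 : ℝ) ≤ t by linarith), measureReal_def]
    have hcl : IsCompact (AffineMap.homothety (v j) t '' T) :=
      (isCompact_simplex v).image (AffineMap.continuous_of_finiteDimensional _)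
    have h1 := setIntegral_mono_set (s := AffineMap.homothety (v j) t '' T) hint
      (Filter.Eventually.of_forall fun x => sq_nonneg _) (hsub.eventuallyLE)
    refine le_trans ?_ h1
    have h2 := setIntegral_ge_of_const_le (c := a ^ 2 / 4) hcl.measurableSet
      (ne_top_of_le_ne_top (simplex_measure hv).2 (measure_mono hsub))
      (by rintro _ ⟨x, hx, rfl⟩; exact hbd x hx) (hint.mono_set hsub)
    refine le_trans ?_ h2
    rw [hmeas, smul_eq_mul]
    have h3 : (1 / 8 : ℝ) ^ d ≤ t ^ d := pow_le_pow_left₀ (by norm_num) ht d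
    have h4 : a ^ 2 / (4 * 8 ^ d) = (1 / 8 : ℝ) ^ d * (a ^ 2 / 4) := by
      rw [div_pow, one_pow]; field_simp
    rw [h4]
    have h5 : 0 ≤ (a ^ 2 / 4) * (μHE[d] : Measure (E n)).real T := by positivity
    nlinarith [mul_le_mul_of_nonneg_right h3 h5]
  -- For small `s`, shrink towards another vertex: there `λ_k ≤ 1 / 8`, so `|s λ_k| ≤ |a| / 2`. Such
  -- a vertex exists because `d ≥ 1`. For large `s`, shrink towards `v k`: there `λ_k ≥ 1 / 2`, so
  -- `|s λ_k| ≥ 2 |a|`.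
  by_cases hs : |s| ≤ 4 * |a|
  · obtain ⟨j, hj⟩ : ∃ j, j ≠ k := by
      have : Nontrivial (Fin (d + 1)) := Fin.nontrivial_iff_two_le.2 (by omega)
      exact exists_ne k
    refine key j (1 / 8) le_rfl (by norm_num) fun x hx => ?_
    obtain ⟨h1, h2⟩ := barycentric_mem hl hx
    have h3 := hl j hj
    have h4 : l (AffineMap.homothety (v j) (1 / 8 : ℝ) x - v k) =
        (1 / 8) * (l (x - v k) + 1) - 1 := by
      rw [AffineMap.homothety_apply, vsub_eq_sub, vadd_eq_add]
      simp only [map_sub, map_add, map_smul, smul_eq_mul] at h3 ⊢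
      linarith
    rw [h4]
    set y := (1 / 8 : ℝ) * (l (x - v k) + 1) with hy
    have hy0 : 0 ≤ y := by linarith
    have hy1 : y ≤ 1 / 8 := by linarith
    have h5 : |s * y| ≤ |a| / 2 := by
      rw [abs_mul, abs_of_nonneg hy0]; nlinarith [abs_nonneg s, abs_nonneg a]
    have h6 : |a| / 2 ≤ |s * y - a| := by
      have := abs_sub_abs_le_abs_sub a (s * y)
      rw [abs_sub_comm] at this
      linarith
    have h7 : (|a| / 2) ^ 2 ≤ |s * y - a| ^ 2 := pow_le_pow_left₀ (by positivity) h6 2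
    rw [sq_abs, div_pow, sq_abs] at h7
    convert h7 using 2
    · norm_num
    · ring
  · push Not at hs
    refine key k (1 / 2) (by norm_num) (by norm_num) fun x hx => ?_
    obtain ⟨h1, h2⟩ := barycentric_mem hl hx
    have h4 : l (AffineMap.homothety (v k) (1 / 2 : ℝ) x - v k) = (1 / 2) * l (x - v k) := by
      rw [AffineMap.homothety_apply, vsub_eq_sub, vadd_eq_add]
      simp
    rw [h4]
    set y := 1 + (1 / 2 : ℝ) * l (x - v k) with hy
    have hy0 : 1 / 2 ≤ y := by linarith
    have h5 : 2 * |a| ≤ |s * y| := by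
      rw [abs_mul, abs_of_nonneg (by linarith : 0 ≤ y)]; nlinarith [abs_nonneg s, abs_nonneg a]
    have h6 : |a| ≤ |s * y - a| := by
      have := abs_sub_abs_le_abs_sub (s * y) a
      linarith
    have h7 : |a| ^ 2 ≤ |s * y - a| ^ 2 := pow_le_pow_left₀ (by positivity) h6 2
    rw [sq_abs, sq_abs] at h7
    linarith [sq_nonneg a]

/-- A simplex containing a ball of radius `r` has barycentric coordinates with gradient at most
`1 / r`. -/
lemma barycentric_le_of_ball (hl : ∀ j, j ≠ k → l (v j - v k) = -1) {c : E n}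
    (hc : c ∈ affineSpan ℝ (Set.range v)) {r : ℝ} (hr : 0 < r)
    (hball : Metric.closedBall c r ∩ (affineSpan ℝ (Set.range v) : Set (E n)) ⊆
      convexHull ℝ (Set.range v)) {w : E n} (hw : w ∈ vectorSpan ℝ (Set.range v)) :
    r * |l w| ≤ ‖w‖ := by
  by_cases h0 : w = 0
  · simp [h0]
  have hwn : 0 < ‖w‖ := norm_pos_iff.2 h0
  have h1 := barycentric_mem hl (hball ⟨Metric.mem_closedBall_self hr.le, hc⟩)
  have hmem : (r / ‖w‖) • w + c ∈ affineSpan ℝ (Set.range v) := by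
    refine AffineSubspace.vadd_mem_of_mem_direction ?_ hc
    rw [direction_affineSpan]
    exact Submodule.smul_mem _ _ hw
  have h2 := barycentric_mem hl (hball (a := (r / ‖w‖) • w + c) ⟨by
    rw [Metric.mem_closedBall, dist_eq_norm, add_sub_cancel_right, norm_smul, norm_div, norm_norm,
      Real.norm_of_nonneg hr.le, div_mul_cancel₀ _ hwn.ne'], hmem⟩)
  simp only [map_sub, map_add, map_smul, smul_eq_mul] at h1 h2
  -- The centre and a point at distance `r` from it both lie in the simplex, where `λ_k` varies by
  -- at most `1`.
  have h3 : |r / ‖w‖ * l w| ≤ 1 := abs_le.2 ⟨by linarith, by linarith⟩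
  rw [abs_mul, abs_of_pos (by positivity), div_mul_eq_mul_div, div_le_one hwn] at h3
  exact h3

/-- A substitute for the inscribed-ball bound with no control on `r`; it suffices for positive
definiteness, which is needed without shape regularity. -/
lemma exists_barycentric_le (l : E n →ₗ[ℝ] ℝ) : ∃ r > 0, ∀ w, r * |l w| ≤ ‖w‖ := by
  let L := LinearMap.toContinuousLinearMap l
  refine ⟨(‖L‖ + 1)⁻¹, by positivity, fun w => ?_⟩
  rw [inv_mul_le_iff₀ (by positivity)]
  have := L.le_opNorm w
  have h2 : L w = l w := rfl
  rw [h2, Real.norm_eq_abs] at this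
  nlinarith [norm_nonneg w]

/-- A combination of the fields `x - x_k` of the vertices controls its coefficients. -/
lemma integral_norm_sq_ge (hd : 1 ≤ d) (hv : AffineIndependent ℝ v)
    (hl : ∀ j, j ≠ k → l (v j - v k) = -1) {r : ℝ} (hr : 0 ≤ r)
    (hlr : ∀ w ∈ vectorSpan ℝ (Set.range v), r * |l w| ≤ ‖w‖) (a : Fin (d + 1) → ℝ) :
    r ^ 2 * (a k ^ 2 / (4 * 8 ^ d) *
      (μHE[d] : Measure (E n)).real (convexHull ℝ (Set.range v))) ≤
      ∫ x in convexHull ℝ (Set.range v), ‖∑ j, a j • (x - v j)‖ ^ 2 ∂μHE[d] := by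
  have hlc : Continuous l := l.continuous_of_finiteDimensional
  refine (mul_le_mul_of_nonneg_left (integral_barycentric hd hv hl (a k) (∑ j, a j))
    (sq_nonneg r)).trans ?_
  rw [← integral_const_mul]
  refine setIntegral_mono_on (integrableOn_simplex hv (by fun_prop))
    (integrableOn_simplex hv (by fun_prop)) (isCompact_simplex v).measurableSet fun x hx => ?_
  have hmem : ∑ j, a j • (x - v j) ∈ vectorSpan ℝ (Set.range v) := by
    refine Submodule.sum_mem _ fun j _ => Submodule.smul_mem _ _ ?_
    rw [← direction_affineSpan]
    exact AffineSubspace.vsub_mem_direction (convexHull_subset_affineSpan _ hx)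
      (mem_affineSpan ℝ (Set.mem_range_self j))
  -- Because `l (x - v j) = λ_k(x) - δ_{jk}`, the field is mapped to `s λ_k - a k` with `s = ∑ a_j`.
  have hval : l (∑ j, a j • (x - v j)) = (∑ j, a j) * (1 + l (x - v k)) - a k := by
    have h1 : ∀ j, l (x - v j) = 1 + l (x - v k) - if j = k then 1 else 0 := by
      intro j
      by_cases hj : j = k
      · subst hj; simp
      · have := hl j hj
        simp only [map_sub, if_neg hj] at this ⊢
        linarith
    rw [map_sum, Finset.sum_mul]
    simp_rw [map_smul, smul_eq_mul]
    have h2 : ∀ j, a j * l (x - v j) =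
        a j * (1 + l (x - v k)) - if j = k then a j else 0 := by
      intro j
      rw [h1 j]
      split_ifs <;> ring
    rw [Finset.sum_congr rfl fun j _ => h2 j, Finset.sum_sub_distrib]
    simp
  have h2 := hlr _ hmem
  rw [hval] at h2
  have h3 := pow_le_pow_left₀ (by positivity) h2 2
  rwa [mul_pow, sq_abs] at h3

end Simplex

/-! ### Bounds for the inverse permeability tensor. -/

section InverseTensor

variable {n : ℕ} {K : Matrix (Fin n) (Fin n) ℝ}

lemma toEuclideanLin_mul_apply (A B : Matrix (Fin n) (Fin n) ℝ) (x : E n) :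
    Matrix.toEuclideanLin A (Matrix.toEuclideanLin B x) = Matrix.toEuclideanLin (A * B) x := by
  ext i
  simp [Matrix.toLpLin_apply, Matrix.mulVec_mulVec]

lemma toEuclideanLin_inner_comm (hK : K.IsHermitian) (x y : E n) :
    inner ℝ (Matrix.toEuclideanLin K x) y = inner ℝ (Matrix.toEuclideanLin K y) x := by
  rw [Matrix.isSymmetric_toEuclideanLin_iff.2 hK x y, real_inner_comm]

lemma toEuclideanLin_inner_pos (hK : K.PosDef) {x : E n} (hx : x ≠ 0) :
    0 < inner ℝ (Matrix.toEuclideanLin K x) x := by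
  rw [toEuclideanLin_inner_comm hK.isHermitian]
  have := hK.dotProduct_mulVec_pos (x := x.ofLp) (by simpa using hx)
  simpa [EuclideanSpace.inner_eq_star_dotProduct, dotProduct_comm] using this

lemma toEuclideanLin_inner_nonneg (hK : K.PosDef) (x : E n) :
    0 ≤ inner ℝ (Matrix.toEuclideanLin K x) x := by
  by_cases hx : x = 0
  · simp [hx]
  · exact (toEuclideanLin_inner_pos hK hx).le

lemma toEuclideanLin_inv_cancel (hK : K.PosDef) (x : E n) :
    Matrix.toEuclideanLin K (Matrix.toEuclideanLin K⁻¹ x) = x := by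
  rw [toEuclideanLin_mul_apply, Matrix.mul_nonsing_inv _ (hK.det_pos.ne'.isUnit)]
  ext i
  simp

/-- Cauchy-Schwarz for `K` and `K⁻¹`. -/
lemma norm_pow_four_le (hK : K.PosDef) (w : E n) :
    (‖w‖ ^ 2) ^ 2 ≤ inner ℝ (Matrix.toEuclideanLin K w) w *
      inner ℝ (Matrix.toEuclideanLin K⁻¹ w) w := by
  let F : LinearMap.BilinForm ℝ (E n) :=
    LinearMap.mk₂ ℝ (fun x y => inner ℝ (Matrix.toEuclideanLin K x) y)
      (fun x y z => by simp [inner_add_left]) (fun c x y => by simp [inner_smul_left])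
      (fun x y z => by simp [inner_add_right]) (fun c x y => by simp [inner_smul_right])
  have h := F.apply_mul_apply_le_of_forall_zero_le (toEuclideanLin_inner_nonneg hK) w
    (Matrix.toEuclideanLin K⁻¹ w)
  change inner ℝ (Matrix.toEuclideanLin K w) (Matrix.toEuclideanLin K⁻¹ w) *
    inner ℝ (Matrix.toEuclideanLin K (Matrix.toEuclideanLin K⁻¹ w)) w ≤ _ *
    inner ℝ (Matrix.toEuclideanLin K (Matrix.toEuclideanLin K⁻¹ w)) _ at h
  rw [toEuclideanLin_inner_comm hK.isHermitian w, toEuclideanLin_inv_cancel hK,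
    real_inner_self_eq_norm_sq, real_inner_comm _ w] at h
  rw [sq]
  exact h

/-- Inversion preserves the anisotropy ratio. No eigenvalues are needed: take `ξ = w`, `η = K⁻¹ v`
in the hypothesis and combine with `norm_pow_four_le` and `⟨K⁻¹ v, v⟩ ≤ ‖K⁻¹ v‖ ‖v‖`. -/
lemma inv_anisotropy (hK : K.PosDef) {κ : ℝ}
    (h : ∀ ξ η : E n, inner ℝ ξ (Matrix.toEuclideanLin K ξ) * ‖η‖ ^ 2 ≤
      κ * (inner ℝ η (Matrix.toEuclideanLin K η) * ‖ξ‖ ^ 2)) (v w : E n) :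
    inner ℝ (Matrix.toEuclideanLin K⁻¹ v) v * ‖w‖ ^ 2 ≤
      κ * (inner ℝ (Matrix.toEuclideanLin K⁻¹ w) w * ‖v‖ ^ 2) := by
  by_cases hv : v = 0
  · simp [hv]
  by_cases hw : w = 0
  · simp [hw]
  have hqv := toEuclideanLin_inner_pos hK.inv hv
  have hqw := toEuclideanLin_inner_pos hK.inv hw
  have h1 := h w (Matrix.toEuclideanLin K⁻¹ v)
  rw [toEuclideanLin_inv_cancel hK] at h1
  have h2 := norm_pow_four_le hK w
  rw [real_inner_comm] at h1
  have h3 : inner ℝ (Matrix.toEuclideanLin K⁻¹ v) v ^ 2 ≤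
      ‖Matrix.toEuclideanLin K⁻¹ v‖ ^ 2 * ‖v‖ ^ 2 := by
    rw [← mul_pow, ← sq_abs]
    exact pow_le_pow_left₀ (abs_nonneg _) (abs_real_inner_le_norm _ _) 2
  have hw' : 0 < ‖w‖ ^ 2 := by positivity
  have hv' : 0 < ‖v‖ ^ 2 := by positivity
  have hy' : 0 ≤ ‖Matrix.toEuclideanLin K⁻¹ v‖ ^ 2 := by positivity
  generalize inner ℝ (Matrix.toEuclideanLin K⁻¹ v) v = qv at *
  generalize inner ℝ (Matrix.toEuclideanLin K⁻¹ w) w = qw at *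
  generalize inner ℝ (Matrix.toEuclideanLin K w) w = kw at *
  generalize ‖Matrix.toEuclideanLin K⁻¹ v‖ ^ 2 = y at *
  generalize ‖w‖ ^ 2 = W at *
  generalize ‖v‖ ^ 2 = V at *
  have h4 : W * (W * y) ≤ W * (κ * qv * qw) := by
    have e1 := mul_le_mul_of_nonneg_right h2 hy'
    have e2 := mul_le_mul_of_nonneg_right h1 hqw.le
    linarith
  have h5 := le_of_mul_le_mul_left h4 hw'
  have h6 : qv * (qv * W) ≤ qv * (κ * (qw * V)) := by
    have e1 := mul_le_mul_of_nonneg_right h3 hw'.le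
    have e2 := mul_le_mul_of_nonneg_right h5 hv'.le
    linarith
  exact le_of_mul_le_mul_left h6 hqv

lemma exists_inv_coercive (hK : K.PosDef) :
    ∃ α > 0, ∀ w : E n, α * ‖w‖ ^ 2 ≤ inner ℝ (Matrix.toEuclideanLin K⁻¹ w) w := by
  let L := LinearMap.toContinuousLinearMap (Matrix.toEuclideanLin K)
  refine ⟨(‖L‖ + 1)⁻¹, by positivity, fun w => ?_⟩
  rw [inv_mul_le_iff₀ (by positivity)]
  by_cases hw : w = 0
  · simp [hw]
  have hw' : 0 < ‖w‖ ^ 2 := by positivity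
  have h1 := norm_pow_four_le hK w
  have h2 : inner ℝ (Matrix.toEuclideanLin K w) w ≤ (‖L‖ + 1) * ‖w‖ ^ 2 := by
    have e1 := real_inner_le_norm (Matrix.toEuclideanLin K w) w
    have e2 : ‖Matrix.toEuclideanLin K w‖ ≤ ‖L‖ * ‖w‖ := L.le_opNorm w
    nlinarith [norm_nonneg w]
  have h3 := toEuclideanLin_inner_nonneg hK.inv w
  have h4 := mul_le_mul_of_nonneg_right h2 h3
  nlinarith

end InverseTensor

/-! ### Local mass matrices against their diagonals. -/

section LocalMass

variable {n d : ℕ} {v : Fin (d + 1) → E n} {Q : E n →ₗ[ℝ] E n} {c : Fin (d + 1) → ℝ}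

/-- The matrix of the local Raviart-Thomas functions `c_k (x - x_k)` on a simplex. -/
noncomputable def localMass (v : Fin (d + 1) → E n) (Q : E n →ₗ[ℝ] E n) (c : Fin (d + 1) → ℝ)
    (k l : Fin (d + 1)) : ℝ :=
  ∫ x in convexHull ℝ (Set.range v),
    inner ℝ (Q (c k • (x - v k))) (c l • (x - v l)) ∂μHE[d]

lemma sum_localMass (hv : AffineIndependent ℝ v) (u : Fin (d + 1) → ℝ) :
    ∑ k, ∑ l, u k * u l * localMass v Q c k l =
      ∫ x in convexHull ℝ (Set.range v),
        inner ℝ (Q (∑ k, (u k * c k) • (x - v k))) (∑ k, (u k * c k) • (x - v k)) ∂μHE[d] := by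
  have hQ : Continuous Q := Q.continuous_of_finiteDimensional
  have hi : ∀ k l, IntegrableOn (fun x => u k * u l *
      inner ℝ (Q (c k • (x - v k))) (c l • (x - v l))) (convexHull ℝ (Set.range v)) μHE[d] :=
    fun k l => integrableOn_simplex hv (by fun_prop)
  simp_rw [localMass, ← integral_const_mul]
  rw [Finset.sum_congr rfl fun k _ =>
    (integral_finsetSum Finset.univ fun l _ => hi k l).symm]
  rw [← integral_finsetSum Finset.univ fun k _ =>
    integrable_finsetSum Finset.univ fun l _ => hi k l]
  refine integral_congr_ae (Filter.Eventually.of_forall fun x => ?_)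
  simp only [map_sum, sum_inner]
  refine Finset.sum_congr rfl fun k _ => ?_
  rw [inner_sum]
  refine Finset.sum_congr rfl fun l _ => ?_
  simp only [map_smul, inner_smul_left, inner_smul_right]
  simp
  ring

lemma mul_localMass_self (u : ℝ) (k : Fin (d + 1)) :
    u * u * localMass v Q c k k = ∫ x in convexHull ℝ (Set.range v),
      (u * c k) ^ 2 * inner ℝ (Q (x - v k)) (x - v k) ∂μHE[d] := by
  rw [localMass, ← integral_const_mul]
  refine integral_congr_ae (Filter.Eventually.of_forall fun x => ?_)
  simp only [map_smul, inner_smul_left, inner_smul_right]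
  simp
  ring

lemma localMass_comm (hsymm : ∀ x y, inner ℝ (Q x) y = inner ℝ (Q y) x) (k l : Fin (d + 1)) :
    localMass v Q c k l = localMass v Q c l k := by
  simp_rw [localMass, hsymm (c k • _)]

/-- Summing `2 ⟨Q y_k, y_l⟩ ≤ ⟨Q y_k, y_k⟩ + ⟨Q y_l, y_l⟩` over all pairs; the cardinality becomes
the upper constant of the spectral equivalence. -/
lemma inner_sum_le {ι : Type*} [Fintype ι] (hsymm : ∀ x y, inner ℝ (Q x) y = inner ℝ (Q y) x)
    (hpos : ∀ x, 0 ≤ inner ℝ (Q x) x) (y : ι → E n) :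
    inner ℝ (Q (∑ k, y k)) (∑ k, y k) ≤ Fintype.card ι * ∑ k, inner ℝ (Q (y k)) (y k) := by
  simp only [map_sum, sum_inner, inner_sum]
  have h : ∀ k l, inner ℝ (Q (y k)) (y l) ≤
      (inner ℝ (Q (y k)) (y k) + inner ℝ (Q (y l)) (y l)) / 2 := by
    intro k l
    have := hpos (y k - y l)
    rw [map_sub, inner_sub_left, inner_sub_right, inner_sub_right, hsymm (y l) (y k)] at this
    linarith
  refine (Finset.sum_le_sum fun k _ => Finset.sum_le_sum fun l _ => h l k).trans (le_of_eq ?_)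
  simp only [add_div, Finset.sum_add_distrib, Finset.sum_const, Finset.card_univ, nsmul_eq_mul,
    ← Finset.mul_sum, ← Finset.sum_div]
  ring

lemma sum_localMass_le (hv : AffineIndependent ℝ v)
    (hsymm : ∀ x y, inner ℝ (Q x) y = inner ℝ (Q y) x) (hpos : ∀ x, 0 ≤ inner ℝ (Q x) x)
    (u : Fin (d + 1) → ℝ) :
    ∑ k, ∑ l, u k * u l * localMass v Q c k l ≤
      (d + 1 : ℝ) * ∑ k, u k * u k * localMass v Q c k k := by
  have hQ : Continuous Q := Q.continuous_of_finiteDimensional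
  rw [sum_localMass hv]
  simp_rw [mul_localMass_self]
  rw [← integral_finsetSum Finset.univ fun k _ => integrableOn_simplex hv (by fun_prop),
    ← integral_const_mul]
  refine setIntegral_mono_on (integrableOn_simplex hv (by fun_prop))
    (integrableOn_simplex hv (by fun_prop)) (isCompact_simplex v).measurableSet fun x _ => ?_
  refine (inner_sum_le hsymm hpos _).trans (le_of_eq ?_)
  simp only [Fintype.card_fin, Nat.cast_add, Nat.cast_one]
  congr 1
  refine Finset.sum_congr rfl fun k _ => ?_
  simp only [map_smul, inner_smul_left, inner_smul_right]
  simp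
  ring

lemma sum_localMass_pos (hd : 1 ≤ d) (hv : AffineIndependent ℝ v) {α : ℝ} (hα : 0 < α)
    (hQα : ∀ x, α * ‖x‖ ^ 2 ≤ inner ℝ (Q x) x) (hc : ∀ k, 0 < c k) {u : Fin (d + 1) → ℝ}
    (hu : u ≠ 0) : 0 < ∑ k, ∑ l, u k * u l * localMass v Q c k l := by
  have hQ : Continuous Q := Q.continuous_of_finiteDimensional
  obtain ⟨k, hk⟩ : ∃ k, u k ≠ 0 := by
    by_contra! h
    exact hu (funext h)
  obtain ⟨l, hl⟩ := exists_barycentric hv k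
  obtain ⟨r, hr, hlr⟩ := exists_barycentric_le l
  have h1 := integral_norm_sq_ge hd hv hl hr.le (fun w _ => hlr w) fun k => u k * c k
  have h2 := simplex_measureReal_pos hv
  have h3 := hc k
  rw [sum_localMass hv]
  refine lt_of_lt_of_le (?_ : 0 < α * ∫ x in convexHull ℝ (Set.range v),
    ‖∑ j, (u j * c j) • (x - v j)‖ ^ 2 ∂μHE[d]) ?_
  · exact mul_pos hα (lt_of_lt_of_le (by positivity) h1)
  · rw [← integral_const_mul]
    exact setIntegral_mono_on (integrableOn_simplex hv (by fun_prop))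
      (integrableOn_simplex hv (by fun_prop)) (isCompact_simplex v).measurableSet
      fun x _ => hQα _

/-- The factor `σ²` comes from `|x - v k| ≤ σ r` against the gradient bound `1 / r`, the factor `4 *
8 ^ d` from `integral_barycentric`, and `d + 1` from summing over the facets. -/
lemma localMass_diag_le (hd : 1 ≤ d) (hv : AffineIndependent ℝ v)
    (hpos : ∀ x, x ≠ 0 → 0 < inner ℝ (Q x) x) {κ : ℝ}
    (hκ : ∀ x y, inner ℝ (Q x) x * ‖y‖ ^ 2 ≤ κ * (inner ℝ (Q y) y * ‖x‖ ^ 2)) {σ r : ℝ}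
    (hr : 0 < r) {o : E n} (ho : o ∈ affineSpan ℝ (Set.range v))
    (hball : Metric.closedBall o r ∩ (affineSpan ℝ (Set.range v) : Set (E n)) ⊆
      convexHull ℝ (Set.range v))
    (hdiam : Metric.diam (convexHull ℝ (Set.range v)) ≤ σ * r) (u : Fin (d + 1) → ℝ) :
    ∑ k, u k * u k * localMass v Q c k k ≤
      ((d + 1) * (κ ^ 2 * σ ^ 2 * (4 * 8 ^ d))) *
        ∑ k, ∑ l, u k * u l * localMass v Q c k l := by
  have hQ : Continuous Q := Q.continuous_of_finiteDimensional
  rw [sum_localMass hv]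
  set I := ∫ x in convexHull ℝ (Set.range v),
    inner ℝ (Q (∑ k, (u k * c k) • (x - v k))) (∑ k, (u k * c k) • (x - v k)) ∂μHE[d] with hI
  set J := ∫ x in convexHull ℝ (Set.range v), ‖∑ k, (u k * c k) • (x - v k)‖ ^ 2 ∂μHE[d] with hJ
  set m := (μHE[d] : Measure (E n)).real (convexHull ℝ (Set.range v)) with hm
  have hms := (isCompact_simplex v).measurableSet
  -- A reference vector: `⟨Q w, w⟩ / ‖w‖²` serves as the scalar size of `Q`. Comparing `Q` with it
  -- from above and from below costs `κ` each time.
  obtain ⟨w, hw⟩ : ∃ w : E n, w ≠ 0 := by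
    refine ⟨v ⟨1, by omega⟩ - v 0, sub_ne_zero.2 fun h => ?_⟩
    simpa using congrArg Fin.val (hv.injective h)
  have hw' : 0 < ‖w‖ ^ 2 := by positivity
  have hqw := hpos w hw
  have hκ1 : 1 ≤ κ := by
    have h := hκ w w
    by_contra! h1
    nlinarith [mul_pos hqw hw']
  have hIJ : inner ℝ (Q w) w * J ≤ κ * ‖w‖ ^ 2 * I := by
    rw [hI, hJ, ← integral_const_mul, ← integral_const_mul]
    refine setIntegral_mono_on (integrableOn_simplex hv (by fun_prop))
      (integrableOn_simplex hv (by fun_prop)) hms fun x _ => ?_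
    linarith [hκ w (∑ k, (u k * c k) • (x - v k))]
  have hterm : ∀ k, u k * u k * localMass v Q c k k ≤ κ ^ 2 * σ ^ 2 * (4 * 8 ^ d) * I := by
    intro k
    obtain ⟨l, hl⟩ := exists_barycentric hv k
    have h1 := integral_norm_sq_ge hd hv hl hr.le
      (fun w hw => barycentric_le_of_ball hl ho hr hball hw) fun k => u k * c k
    have h2 : ‖w‖ ^ 2 * (u k * u k * localMass v Q c k k) ≤
        κ * inner ℝ (Q w) w * ((u k * c k) ^ 2 * (σ * r) ^ 2 * m) := by
      rw [mul_localMass_self, ← integral_const_mul]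
      have h3 : ∀ x ∈ convexHull ℝ (Set.range v),
          ‖w‖ ^ 2 * ((u k * c k) ^ 2 * inner ℝ (Q (x - v k)) (x - v k)) ≤
            κ * inner ℝ (Q w) w * ((u k * c k) ^ 2 * (σ * r) ^ 2) := by
        intro x hx
        have h4 : ‖x - v k‖ ≤ σ * r := by
          rw [← dist_eq_norm]
          exact (Metric.dist_le_diam_of_mem (isCompact_simplex v).isBounded hx
            (subset_convexHull ℝ _ (Set.mem_range_self k))).trans hdiam
        have h5 := pow_le_pow_left₀ (norm_nonneg _) h4 2
        have h6 := mul_le_mul_of_nonneg_left h5 (by positivity : 0 ≤ κ * inner ℝ (Q w) w)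
        have h7 := hκ (x - v k) w
        have h8 := mul_le_mul_of_nonneg_left (h7.trans ((mul_assoc _ _ _).symm.trans_le h6))
          (sq_nonneg (u k * c k))
        linarith
      have h9 := setIntegral_mono_on (μ := (μHE[d] : Measure (E n)))
        (integrableOn_simplex hv (by fun_prop))
        (integrableOn_simplex hv continuous_const) hms h3
      refine h9.trans (le_of_eq ?_)
      rw [setIntegral_const, smul_eq_mul]
      ring
    have h10 : (u k * c k) ^ 2 * (σ * r) ^ 2 * m ≤ σ ^ 2 * (4 * 8 ^ d) * J := by
      have e : (u k * c k) ^ 2 * (σ * r) ^ 2 * m =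
          σ ^ 2 * (4 * 8 ^ d) * (r ^ 2 * ((u k * c k) ^ 2 / (4 * 8 ^ d) * m)) := by
        field_simp
      rw [e]
      exact mul_le_mul_of_nonneg_left h1 (by positivity)
    have h11 := mul_le_mul_of_nonneg_left h10 (by positivity : 0 ≤ κ * inner ℝ (Q w) w)
    have h12 := mul_le_mul_of_nonneg_left hIJ
      (by positivity : 0 ≤ κ * (σ ^ 2 * (4 * 8 ^ d)))
    refine le_of_mul_le_mul_left (?_ : ‖w‖ ^ 2 * _ ≤ ‖w‖ ^ 2 * _) hw'
    linarith
  refine (Finset.sum_le_sum fun k _ => hterm k).trans (le_of_eq ?_)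
  simp
  ring

end LocalMass

/-! ### Divergence pairing on the meshes and injectivity of `Bᵀ`. -/

lemma facet_measureReal_pos {n d : ℕ} {v : Fin (d + 1) → E n} (hd : d ≠ 0)
    (hv : AffineIndependent ℝ v) (k : Fin (d + 1)) :
    0 < (μHE[d - 1] : Measure (E n)).real (convexHull ℝ (v '' {k}ᶜ)) := by
  obtain ⟨d, rfl⟩ := Nat.exists_eq_succ_of_ne_zero hd
  rw [← Fin.range_succAbove, ← Set.range_comp]
  exact simplex_measureReal_pos (hv.comp_embedding k.succAboveEmb)

lemma sum_measureReal_inter {X ι : Type*} [MeasurableSpace X] {μ : Measure X} {s : Finset ι}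
    {f : ι → Set X} (hf : ∀ i, MeasurableSet (f i))
    (hnull : ∀ i ∈ s, ∀ j ∈ s, i ≠ j → μ (f i ∩ f j) = 0) {A : Set X} (hA : MeasurableSet A)
    (hAfin : μ A ≠ ⊤) (hcover : A ⊆ ⋃ i ∈ s, f i) :
    ∑ i ∈ s, μ.real (f i ∩ A) = μ.real A := by
  simp_rw [measureReal_def]
  rw [← ENNReal.toReal_sum fun i _ =>
      ne_top_of_le_ne_top hAfin (measure_mono Set.inter_subset_right),
    ← measure_biUnion_finset₀]
  · congr 2
    rw [← Set.iUnion₂_inter]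
    exact Set.inter_eq_right.2 hcover
  · intro i hi j hj hij
    exact measure_mono_null (Set.inter_subset_inter Set.inter_subset_left Set.inter_subset_left)
      (hnull i hi j hj hij)
  · exact fun i _ => ((hf i).inter hA).nullMeasurableSet

namespace Mesh

variable {n : ℕ} (G : Mesh n)

lemma cellVol_pos (i : G.Sub) (T : G.Cell i) : 0 < G.cellVol i T :=
  simplex_measureReal_pos (G.vert_indep i T)

lemma facetVol_pos {i : G.Sub} (hi : G.dim i ≠ 0) (T : G.Cell i) (k : Fin (G.dim i + 1)) :
    0 < G.facetVol i T k :=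
  facet_measureReal_pos hi (G.vert_indep i T) k

lemma rtCoef_pos {i : G.Sub} (hi : G.dim i ≠ 0) (T : G.Cell i) (k : Fin (G.dim i + 1)) :
    0 < G.rtCoef i T k := by
  have h1 := G.facetVol_pos hi T k
  have h2 := G.cellVol_pos i T
  have h3 : (0 : ℝ) < G.dim i := by exact_mod_cast Nat.pos_of_ne_zero hi
  unfold rtCoef
  positivity

lemma rtCoef_eq_zero {i : G.Sub} (hi : G.dim i = 0) (T : G.Cell i) (k : Fin (G.dim i + 1)) :
    G.rtCoef i T k = 0 := by
  simp [rtCoef, hi]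

lemma dim_ne_zero_of_kind_ne {i : G.Sub} {F : G.Cell i × Fin (G.dim i + 1)}
    (h : G.kind i F ≠ .neumann) : G.dim i ≠ 0 :=
  fun h0 => h (G.kind_point i F h0)

lemma dim_le (i : G.Sub) : G.dim i ≤ n := by
  have h := (G.vert_indep i (Classical.arbitrary _)).card_le_finrank_succ
  have h2 := Submodule.finrank_le
    (vectorSpan ℝ (Set.range (G.vert i (Classical.arbitrary _))))
  rw [Fintype.card_fin] at h
  rw [finrank_euclideanSpace_fin] at h2
  omega

lemma isCompact_facetSet (i : G.Sub) (T : G.Cell i) (k : Fin (G.dim i + 1)) :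
    IsCompact (G.facetSet i T k) :=
  (Set.toFinite _).isCompact_convexHull ℝ

/-- The facets of all cells. -/
abbrev Facet : Type := Σ i, G.Cell i × Fin (G.dim i + 1)

/-- Gauss' theorem on the cells, paired with a pressure. -/
lemma sum_divCell (p : G.Qh) {u : G.Flux} (hu : u ∈ G.Vh) :
    ∑ i, ∑ T, p i T * (G.divCell u i T * G.cellVol i T) =
      ∑ x : G.Facet, p x.1 x.2.1 * (u x.1 x.2.1 x.2.2 * G.facetVol x.1 x.2.1 x.2.2) := by
  rw [Fintype.sum_sigma]
  simp_rw [Fintype.sum_prod_type]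
  refine Finset.sum_congr rfl fun i _ => Finset.sum_congr rfl fun T _ => ?_
  rw [← Finset.mul_sum, divCell, Finset.sum_mul]
  congr 1
  refine Finset.sum_congr rfl fun k _ => ?_
  -- In a point the coefficient `|f| / (d |T|)` has denominator `0`; there both sides vanish, as
  -- `V_h` has no flux in points.
  by_cases hi : G.dim i = 0
  · simp [hu.2 i (T, k) (G.kind_point i _ hi)]
  · have h1 := G.cellVol_pos i T
    have h2 : (G.dim i : ℝ) ≠ 0 := by exact_mod_cast hi
    rw [rtCoef]
    field_simp

lemma total_zero_right (u : G.V0h) : G.total (u, 0) = u := by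
  simp [total]

lemma total_zero_left (μ : G.Lam) : G.total (0, μ) = G.Rh μ := by
  simp [total]

lemma total_mem (r : G.Wh) : G.total r ∈ G.Vh := by
  exact G.Vh.add_mem r.1.2.1 (G.Rh r.2).2

variable {G} {p : G.Qh}

lemma divPairing_eq_zero (hp : G.opBT p = 0) (r : G.Wh) : G.divPairing r p = 0 := by
  have := LinearMap.congr_fun hp r
  exact neg_eq_zero.1 this

lemma sum_flux_eq_zero (hp : G.opBT p = 0) {u : G.Flux} (hu : u ∈ G.V0h) :
    ∑ x : G.Facet, p x.1 x.2.1 * (u x.1 x.2.1 x.2.2 * G.facetVol x.1 x.2.1 x.2.2) = 0 := by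
  have h := divPairing_eq_zero hp (⟨u, hu⟩, 0)
  rw [divPairing, total_zero_right, G.sum_divCell p hu.1] at h
  simpa using h

/-- Tested against the unit flux across the common facet, which is `1` seen from one cell and `-1`
from the other; glued facets have the same vertices, hence equal area. -/
lemma pressure_glued (hp : G.opBT p = 0) {i : G.Sub} {F F' : G.Cell i × Fin (G.dim i + 1)}
    (hF : G.kind i F = .glued F') : p i F.1 = p i F'.1 := by
  classical
  have hF' := G.glued_symm i F F' hF
  let u : G.Flux := fun j S l =>
    (if (⟨j, S, l⟩ : G.Facet) = ⟨i, F⟩ then (1 : ℝ) else 0) -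
      if (⟨j, S, l⟩ : G.Facet) = ⟨i, F'⟩ then (1 : ℝ) else 0
  have hzero : ∀ j (H : G.Cell j × Fin (G.dim j + 1)), (∀ H', G.kind j H ≠ .glued H') →
      u j H.1 H.2 = 0 := by
    intro j H hH
    have h1 : (⟨j, H⟩ : G.Facet) ≠ ⟨i, F⟩ := by
      rintro h; cases h; exact hH _ hF
    have h2 : (⟨j, H⟩ : G.Facet) ≠ ⟨i, F'⟩ := by
      rintro h; cases h; exact hH _ hF'
    simp only [u, if_neg h1, if_neg h2, sub_zero]
  have hu : u ∈ G.V0h := by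
    refine ⟨⟨fun j H H' h => ?_, fun j H h => ?_⟩, fun j H e h => ?_⟩
    · have h' := G.glued_symm j H H' h
      have e1 : (⟨j, H⟩ : G.Facet) = ⟨i, F⟩ ↔ (⟨j, H'⟩ : G.Facet) = ⟨i, F'⟩ := by
        constructor
        · intro e; cases e; rw [hF] at h; cases h; rfl
        · intro e; cases e; rw [hF'] at h'; cases h'; rfl
      have e2 : (⟨j, H⟩ : G.Facet) = ⟨i, F'⟩ ↔ (⟨j, H'⟩ : G.Facet) = ⟨i, F⟩ := by
        constructor
        · intro e; cases e; rw [hF'] at h; cases h; rfl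
        · intro e; cases e; rw [hF] at h'; cases h'; rfl
      simp only [u, e1, e2, neg_sub]
    · exact hzero j H (by simp [h])
    · exact hzero j H (by simp [h])
  have h := sum_flux_eq_zero hp hu
  simp only [u, sub_mul, ite_mul, one_mul, zero_mul, mul_sub, mul_ite, mul_zero,
    Finset.sum_sub_distrib, Finset.sum_ite_eq', Finset.mem_univ, if_true] at h
  have hvol : G.facetVol i F.1 F.2 = G.facetVol i F'.1 F'.2 := by
    simp only [facetVol, facetSet, G.glued_vert i F F' hF]
  rw [hvol, ← sub_mul] at h
  have hd := G.dim_ne_zero_of_kind_ne (F := F) (by simp [hF])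
  exact sub_eq_zero.1 ((mul_eq_zero.1 h).resolve_right (G.facetVol_pos hd _ _).ne')

lemma pressure_dirichlet (hp : G.opBT p = 0) {i : G.Sub} {F : G.Cell i × Fin (G.dim i + 1)}
    (hF : G.kind i F = .dirichlet) : p i F.1 = 0 := by
  classical
  let u : G.Flux := fun j S l => if (⟨j, S, l⟩ : G.Facet) = ⟨i, F⟩ then (1 : ℝ) else 0
  have hzero : ∀ j (H : G.Cell j × Fin (G.dim j + 1)), G.kind j H ≠ .dirichlet →
      u j H.1 H.2 = 0 := by
    intro j H hH
    have h1 : (⟨j, H⟩ : G.Facet) ≠ ⟨i, F⟩ := by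
      rintro h; cases h; exact hH hF
    simp only [u, if_neg h1]
  have hu : u ∈ G.V0h := by
    refine ⟨⟨fun j H H' h => ?_, fun j H h => ?_⟩, fun j H e h => ?_⟩
    · rw [hzero j H (by simp [h]), hzero j H' (by simp [G.glued_symm j H H' h]), neg_zero]
    · exact hzero j H (by simp [h])
    · exact hzero j H (by simp [h])
  have h := sum_flux_eq_zero hp hu
  simp only [u, ite_mul, one_mul, zero_mul, mul_ite, mul_zero,
    Finset.sum_ite_eq', Finset.mem_univ, if_true] at h
  have hd := G.dim_ne_zero_of_kind_ne (F := F) (by simp [hF])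
  exact (mul_eq_zero.1 h).resolve_right (G.facetVol_pos hd _ _).ne'

lemma pressure_const (hp : G.opBT p = 0) (i : G.Sub) (T T' : G.Cell i) : p i T = p i T' := by
  induction G.sub_connected i T T' with
  | refl => rfl
  | tail _ h ih =>
    obtain ⟨k, k', h⟩ := h
    exact ih.trans (pressure_glued hp h)

lemma sum_cell_inter (e : G.Ifc) (m : G.MCell e) :
    ∑ T, (μHE[G.dim (G.lower e)] : Measure (E n)).real
      (G.cellSet (G.lower e) T ∩ G.mcellSet e m) =
      (μHE[G.dim (G.lower e)] : Measure (E n)).real (G.mcellSet e m) := by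
  refine sum_measureReal_inter (fun T => (isCompact_simplex _).measurableSet)
    (fun T _ T' _ h => G.cell_nonoverlap _ T T' h) (isCompact_simplex _).measurableSet
    (simplex_measure (G.mvert_indep e m)).2 ?_
  refine ((Set.subset_iUnion _ m).trans (G.mortar_subset e)).trans ?_
  simp

lemma mortar_facet_nonoverlap (e : G.Ifc) (F F' : G.Cell (G.upper e) × Fin (G.dim (G.upper e) + 1))
    (hF : G.kind (G.upper e) F = .mortar e) (hF' : G.kind (G.upper e) F' = .mortar e)
    (h : F ≠ F') : (μHE[G.dim (G.lower e)] : Measure (E n))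
      (G.facetSet (G.upper e) F.1 F.2 ∩ G.facetSet (G.upper e) F'.1 F'.2) = 0 :=
  G.mortar_nonoverlap e F F' hF hF' h

open Classical in
lemma mcellSet_subset (e : G.Ifc) (m : G.MCell e) :
    G.mcellSet e m ⊆ ⋃ F ∈ Finset.univ.filter fun F => G.kind (G.upper e) F = .mortar e,
      G.facetSet (G.upper e) F.1 F.2 := by
  intro x hx
  have hx' : x ∈ ⋃ m, convexHull ℝ (Set.range (G.mvert e m)) := Set.mem_iUnion.2 ⟨m, hx⟩
  rw [← G.mortar_cover e] at hx'
  simp only [Set.mem_iUnion, exists_prop] at hx' ⊢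
  obtain ⟨F, hF, hx⟩ := hx'
  exact ⟨F, Finset.mem_filter.2 ⟨Finset.mem_univ _, hF⟩, hx⟩

open Classical in
lemma sum_facet_inter (e : G.Ifc) (m : G.MCell e) :
    ∑ F with G.kind (G.upper e) F = .mortar e, (μHE[G.dim (G.lower e)] : Measure (E n)).real
      (G.facetSet (G.upper e) F.1 F.2 ∩ G.mcellSet e m) =
      (μHE[G.dim (G.lower e)] : Measure (E n)).real (G.mcellSet e m) := by
  refine sum_measureReal_inter
    (f := fun F : G.Cell (G.upper e) × Fin (G.dim (G.upper e) + 1) =>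
      G.facetSet (G.upper e) F.1 F.2)
    (fun F => (G.isCompact_facetSet _ _ _).measurableSet)
    (fun F hF F' hF' h => mortar_facet_nonoverlap e F F' (Finset.mem_filter.1 hF).2
      (Finset.mem_filter.1 hF').2 h)
    (isCompact_simplex _).measurableSet ?_ (mcellSet_subset e m)
  exact (simplex_measure (G.mvert_indep e m)).2

/-- Tested against the indicator of one mortar cell. Pressures being constant on each subdomain,
only total overlaps matter: the facets above and the cells below both cover the mortar cell without
overlap, so non-matching meshes do no harm. -/
lemma pressure_interface (hp : G.opBT p = 0) (e : G.Ifc) (S : G.Cell (G.upper e))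
    (T : G.Cell (G.lower e)) : p (G.upper e) S = p (G.lower e) T := by
  classical
  let m : G.MCell e := Classical.arbitrary _
  let μ : G.Lam := Pi.single e (Pi.single m 1)
  have h := divPairing_eq_zero hp (0, μ)
  rw [divPairing, total_zero_left, G.sum_divCell p (G.Rh μ).2] at h
  set A := (μHE[G.dim (G.lower e)] : Measure (E n)).real (G.mcellSet e m) with hA
  have h1 : ∑ x : G.Facet, p x.1 x.2.1 *
      ((G.Rh μ : G.Flux) x.1 x.2.1 x.2.2 * G.facetVol x.1 x.2.1 x.2.2) =
      p (G.upper e) S * A := by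
    rw [Fintype.sum_sigma, Finset.sum_eq_single (G.upper e)]
    · rw [hA, ← sum_facet_inter e m, Finset.mul_sum, Finset.sum_filter]
      refine Finset.sum_congr rfl fun F _ => ?_
      rw [pressure_const hp _ F.1 S]
      by_cases hF : G.kind (G.upper e) F = .mortar e
      · have hd := G.dim_ne_zero_of_kind_ne (F := F) (by simp [hF])
        have hpos := G.facetVol_pos hd F.1 F.2
        simp only [Rh, LinearMap.coe_mk, AddHom.coe_mk, hF, if_true, mortarProj]
        -- The facet area cancels the denominator of the mean value, leaving the area of facet ∩
        -- mortar cell.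
        rw [div_mul_cancel₀ _ hpos.ne', Finset.sum_eq_single m]
        · simp [μ]
        · intro m' _ hm'
          simp [μ, hm']
        · simp
      · rw [if_neg hF]
        simp only [Rh, LinearMap.coe_mk, AddHom.coe_mk]
        cases hk : G.kind (G.upper e) F with
        | mortar e' =>
          have : e' ≠ e := fun h => hF (by rw [hk, h])
          simp [mortarProj, μ, Pi.single_eq_of_ne this]
        | _ => simp
    · intro i _ hi
      refine Finset.sum_eq_zero fun F _ => ?_
      simp only [Rh, LinearMap.coe_mk, AddHom.coe_mk]
      cases hk : G.kind i F with
      | mortar e' =>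
        have : e' ≠ e := fun h => hi (by rw [← G.kind_mortar i F e' hk, h])
        simp [mortarProj, μ, Pi.single_eq_of_ne this]
      | _ => simp
    · simp
  have h2 : ∑ e', ∑ T, ∑ m, p (G.lower e') T * (-(μ e' m) *
      (μHE[G.dim (G.lower e')] : Measure (E n)).real
        (G.cellSet (G.lower e') T ∩ G.mcellSet e' m)) = -(p (G.lower e) T * A) := by
    rw [Finset.sum_eq_single e]
    · rw [hA, ← sum_cell_inter e m, Finset.mul_sum, ← Finset.sum_neg_distrib]
      refine Finset.sum_congr rfl fun T' _ => ?_
      rw [Finset.sum_eq_single m, pressure_const hp _ T' T]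
      · simp [μ]
      · intro m' _ hm'
        simp [μ, hm']
      · simp
    · intro e' _ he'
      simp [μ, Pi.single_eq_of_ne he']
    · simp
  rw [h1, h2] at h
  have hpos : 0 < A := simplex_measureReal_pos (G.mvert_indep e m)
  have h3 : (p (G.upper e) S - p (G.lower e) T) * A = 0 := by linarith
  exact sub_eq_zero.1 ((mul_eq_zero.1 h3).resolve_right hpos.ne')

/-- The transposed divergence operator is injective. -/
lemma opBT_injective (hp : G.opBT p = 0) : p = 0 := by
  have hall : ∀ i j (S : G.Cell i) (T : G.Cell j), p i S = p j T := by
    intro i j S T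
    have h : p i (Classical.arbitrary _) = p j (Classical.arbitrary _) := by
      induction G.connected i j with
      | rel i j h =>
        obtain ⟨e, rfl, rfl⟩ := h
        exact pressure_interface hp e _ _
      | refl => rfl
      | symm _ _ _ ih => exact (ih (Classical.arbitrary _) (Classical.arbitrary _)).symm
      | trans _ _ _ _ _ ih1 ih2 =>
        exact (ih1 (Classical.arbitrary _) (Classical.arbitrary _)).trans
          (ih2 (Classical.arbitrary _) (Classical.arbitrary _))
    rw [pressure_const hp i S, pressure_const hp j T, h]
  obtain ⟨i, F, hF⟩ := G.exists_dirichlet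
  funext j T
  rw [hall j i T F.1, pressure_dirichlet hp hF]
  rfl

end Mesh

/-! ### Definiteness and spectral equivalence of the global forms. -/

namespace Params

variable {n : ℕ} {G : Mesh n} (P : Params G)

lemma mass_eq_zero {i : G.Sub} (hi : G.dim i = 0) (T : G.Cell i) (k l : Fin (G.dim i + 1)) :
    P.mass i T k l = 0 := by
  simp [mass, Mesh.rtBasis, G.rtCoef_eq_zero hi]

lemma mass_comm (i : G.Sub) (T : G.Cell i) (k l : Fin (G.dim i + 1)) :
    P.mass i T k l = P.mass i T l k :=
  localMass_comm (toEuclideanLin_inner_comm (P.K_posDef i).inv.isHermitian) k l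

lemma sum_mass_pos {i : G.Sub} (hi : G.dim i ≠ 0) (T : G.Cell i) {u : Fin (G.dim i + 1) → ℝ}
    (hu : u ≠ 0) : 0 < ∑ k, ∑ l, u k * u l * P.mass i T k l := by
  obtain ⟨α, hα, h⟩ := exists_inv_coercive (P.K_posDef i)
  exact sum_localMass_pos (Nat.one_le_iff_ne_zero.2 hi) (G.vert_indep i T) hα h
    (G.rtCoef_pos hi T) hu

lemma sum_mass_nonneg (i : G.Sub) (T : G.Cell i) (u : Fin (G.dim i + 1) → ℝ) :
    0 ≤ ∑ k, ∑ l, u k * u l * P.mass i T k l := by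
  by_cases hi : G.dim i = 0
  · simp [P.mass_eq_zero hi]
  by_cases hu : u = 0
  · simp [hu]
  · exact (P.sum_mass_pos hi T hu).le

lemma mass_diag_pos {i : G.Sub} (hi : G.dim i ≠ 0) (T : G.Cell i) (k : Fin (G.dim i + 1)) :
    0 < P.mass i T k k := by
  have h := P.sum_mass_pos hi T (u := Pi.single k 1) (by simp)
  simpa [Pi.single_apply] using h

lemma mass_diag_nonneg (i : G.Sub) (T : G.Cell i) (k : Fin (G.dim i + 1)) :
    0 ≤ P.mass i T k k := by
  by_cases hi : G.dim i = 0
  · exact (P.mass_eq_zero hi T k k).ge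
  · exact (P.mass_diag_pos hi T k).le

lemma sum_mass_le (i : G.Sub) (T : G.Cell i) (u : Fin (G.dim i + 1) → ℝ) :
    ∑ k, ∑ l, u k * u l * P.mass i T k l ≤ (n + 1 : ℝ) * ∑ k, u k * u k * P.mass i T k k := by
  refine (sum_localMass_le (G.vert_indep i T)
    (toEuclideanLin_inner_comm (P.K_posDef i).inv.isHermitian)
    (toEuclideanLin_inner_nonneg (P.K_posDef i).inv) u).trans ?_
  refine mul_le_mul_of_nonneg_right ?_ (Finset.sum_nonneg fun k _ =>
    mul_nonneg (mul_self_nonneg _) (P.mass_diag_nonneg i T k))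
  have : (G.dim i : ℝ) ≤ n := by exact_mod_cast G.dim_le i
  linarith

lemma mass_diag_le {σ κ : ℝ} (hσ : G.ShapeRegular σ) (hκ : P.AnisotropyLE κ) (i : G.Sub)
    (T : G.Cell i) (u : Fin (G.dim i + 1) → ℝ) :
    ∑ k, u k * u k * P.mass i T k k ≤ ((n + 1) * (κ ^ 2 * σ ^ 2 * (4 * 8 ^ n))) *
      ∑ k, ∑ l, u k * u l * P.mass i T k l := by
  by_cases hi : G.dim i = 0
  · simp [P.mass_eq_zero hi]
  obtain ⟨o, ho, r, hr, hball, hdiam⟩ := hσ i T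
  refine (localMass_diag_le (Nat.one_le_iff_ne_zero.2 hi) (G.vert_indep i T)
    (fun x hx => toEuclideanLin_inner_pos (P.K_posDef i).inv hx)
    (inv_anisotropy (P.K_posDef i) (hκ i)) hr ho hball hdiam u).trans ?_
  refine mul_le_mul_of_nonneg_right ?_ (P.sum_mass_nonneg i T u)
  have h1 : (G.dim i : ℝ) ≤ n := by exact_mod_cast G.dim_le i
  have h2 : (8 : ℝ) ^ G.dim i ≤ 8 ^ n := pow_le_pow_right₀ (by norm_num) (G.dim_le i)
  gcongr

lemma fluxForm_apply (u v : G.Flux) :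
    P.fluxForm u v = ∑ i, ∑ T, ∑ k, ∑ l, u i T k * v i T l * P.mass i T k l := rfl

lemma fluxFormD_apply (u v : G.Flux) :
    P.fluxFormD u v = ∑ i, ∑ T, ∑ k, u i T k * v i T k * P.mass i T k k := rfl

lemma mortarForm_apply (lam μ : G.Lam) :
    P.mortarForm lam μ = ∑ e, ∑ m, lam e m * μ e m *
      ∫ x in G.mcellSet e m, P.γ e * (P.Kν e x)⁻¹ ∂μHE[G.dim (G.lower e)] := rfl

lemma opA_apply (w r : G.Wh) :
    P.opA w r = P.fluxForm (G.total w) (G.total r) + P.mortarForm w.2 r.2 := rfl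

lemma opDA_apply (w r : G.Wh) :
    P.opDA w r = P.fluxFormD (G.total w) (G.total r) + P.mortarForm w.2 r.2 := rfl

lemma fluxForm_comm (u v : G.Flux) : P.fluxForm u v = P.fluxForm v u := by
  simp_rw [fluxForm_apply]
  refine Finset.sum_congr rfl fun i _ => Finset.sum_congr rfl fun T _ => ?_
  rw [Finset.sum_comm]
  refine Finset.sum_congr rfl fun k _ => Finset.sum_congr rfl fun l _ => ?_
  rw [P.mass_comm, mul_comm (u i T l)]

lemma fluxFormD_comm (u v : G.Flux) : P.fluxFormD u v = P.fluxFormD v u := by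
  simp_rw [fluxFormD_apply, mul_comm (u _ _ _)]

lemma mortarForm_comm (lam μ : G.Lam) : P.mortarForm lam μ = P.mortarForm μ lam := by
  simp_rw [mortarForm_apply, mul_comm (lam _ _)]

lemma fluxForm_nonneg (u : G.Flux) : 0 ≤ P.fluxForm u u :=
  Finset.sum_nonneg fun i _ => Finset.sum_nonneg fun T _ => P.sum_mass_nonneg i T (u i T)

lemma fluxForm_le (u : G.Flux) : P.fluxForm u u ≤ (n + 1 : ℝ) * P.fluxFormD u u := by
  rw [fluxForm_apply, fluxFormD_apply]
  simp_rw [Finset.mul_sum (s := Finset.univ (α := G.Sub)),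
    Finset.mul_sum (s := Finset.univ (α := G.Cell _))]
  exact Finset.sum_le_sum fun i _ => Finset.sum_le_sum fun T _ => P.sum_mass_le i T (u i T)

lemma fluxFormD_le {σ κ : ℝ} (hσ : G.ShapeRegular σ) (hκ : P.AnisotropyLE κ) (u : G.Flux) :
    P.fluxFormD u u ≤ ((n + 1) * (κ ^ 2 * σ ^ 2 * (4 * 8 ^ n))) * P.fluxForm u u := by
  rw [fluxForm_apply, fluxFormD_apply]
  simp_rw [Finset.mul_sum (s := Finset.univ (α := G.Sub)),
    Finset.mul_sum (s := Finset.univ (α := G.Cell _))]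
  exact Finset.sum_le_sum fun i _ => Finset.sum_le_sum fun T _ =>
    P.mass_diag_le hσ hκ i T (u i T)

/-- Membership in `V_h` is essential: the form does not see components in points, and these vanish
in `V_h`. -/
lemma fluxForm_pos {u : G.Flux} (hu : u ∈ G.Vh) (h0 : u ≠ 0) : 0 < P.fluxForm u u := by
  obtain ⟨i, T, k, hk⟩ : ∃ i T k, u i T k ≠ 0 := by
    by_contra! h
    exact h0 (by funext i T k; exact h i T k)
  have hi : G.dim i ≠ 0 := fun h => hk (hu.2 i (T, k) (G.kind_point i _ h))
  rw [fluxForm_apply]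
  refine Finset.sum_pos' (fun i _ => Finset.sum_nonneg fun T _ => P.sum_mass_nonneg i T (u i T))
    ⟨i, Finset.mem_univ _, ?_⟩
  exact Finset.sum_pos' (fun T _ => P.sum_mass_nonneg i T (u i T))
    ⟨T, Finset.mem_univ _, P.sum_mass_pos hi T fun h => hk (congrFun h k)⟩

/-- The upper bound on `Kν` keeps the integrand away from zero; the lower bound makes it integrable.
-/
lemma mortarWeight_pos (e : G.Ifc) (m : G.MCell e) :
    0 < ∫ x in G.mcellSet e m, P.γ e * (P.Kν e x)⁻¹ ∂μHE[G.dim (G.lower e)] := by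
  obtain ⟨a, b, ha, hab⟩ := P.Kν_bounds e
  have hγ := P.γ_pos e
  have hb : 0 < b := ha.trans_le ((hab 0).1.trans (hab 0).2)
  have hfin := (simplex_measure (G.mvert_indep e m)).2
  have hint : IntegrableOn (fun x => P.γ e * (P.Kν e x)⁻¹) (G.mcellSet e m)
      (μHE[G.dim (G.lower e)] : Measure (E n)) := by
    refine Measure.integrableOn_of_bounded (M := P.γ e * a⁻¹) hfin
      ((P.Kν_measurable e).inv.const_mul _).aestronglyMeasurable
      (Filter.Eventually.of_forall fun x => ?_)
    have hx : 0 < P.Kν e x := ha.trans_le (hab x).1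
    rw [Real.norm_of_nonneg (by positivity)]
    exact mul_le_mul_of_nonneg_left (inv_anti₀ ha (hab x).1) hγ.le
  have h := setIntegral_ge_of_const_le (c := P.γ e * b⁻¹)
    (isCompact_simplex (G.mvert e m)).measurableSet hfin
    (fun x _ => mul_le_mul_of_nonneg_left (inv_anti₀ (ha.trans_le (hab x).1) (hab x).2) hγ.le) hint
  refine lt_of_lt_of_le ?_ h
  have := simplex_measureReal_pos (G.mvert_indep e m)
  rw [smul_eq_mul]
  positivity

lemma mortarForm_nonneg (μ : G.Lam) : 0 ≤ P.mortarForm μ μ :=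
  Finset.sum_nonneg fun e _ => Finset.sum_nonneg fun m _ =>
    mul_nonneg (mul_self_nonneg _) (P.mortarWeight_pos e m).le

lemma mortarForm_pos {μ : G.Lam} (h0 : μ ≠ 0) : 0 < P.mortarForm μ μ := by
  obtain ⟨e, m, hm⟩ : ∃ e m, μ e m ≠ 0 := by
    by_contra! h
    exact h0 (by funext e m; exact h e m)
  have hnn : ∀ e m, 0 ≤ μ e m * μ e m *
      ∫ x in G.mcellSet e m, P.γ e * (P.Kν e x)⁻¹ ∂μHE[G.dim (G.lower e)] := fun e m =>
    mul_nonneg (mul_self_nonneg _) (P.mortarWeight_pos e m).le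
  rw [mortarForm_apply]
  refine Finset.sum_pos' (fun e _ => Finset.sum_nonneg fun m _ => hnn e m)
    ⟨e, Finset.mem_univ _, ?_⟩
  exact Finset.sum_pos' (fun m _ => hnn e m)
    ⟨m, Finset.mem_univ _, mul_pos (mul_self_pos.2 hm) (P.mortarWeight_pos e m)⟩

lemma opA_pos {r : G.Wh} (hr : r ≠ 0) : 0 < P.opA r r := by
  rw [opA_apply]
  by_cases h2 : r.2 = 0
  · have h1 : r.1 ≠ 0 := fun h1 => hr (Prod.ext h1 h2)
    have htot : G.total r = r.1 := by
      rw [← G.total_zero_right r.1, ← h2]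
    refine add_pos_of_pos_of_nonneg (P.fluxForm_pos (G.total_mem r) ?_) (P.mortarForm_nonneg _)
    rw [htot]
    exact fun h => h1 (Subtype.ext h)
  · exact add_pos_of_nonneg_of_pos (P.fluxForm_nonneg _) (P.mortarForm_pos h2)

lemma symmPosDef_opA : SymmPosDef P.opA :=
  ⟨fun x y => by rw [opA_apply, opA_apply, fluxForm_comm, mortarForm_comm], fun _ => P.opA_pos⟩

lemma opA_le (r : G.Wh) : P.opA r r ≤ (n + 1 : ℝ) * P.opDA r r := by
  have h1 := P.fluxForm_le (G.total r)
  have h2 := P.mortarForm_nonneg r.2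
  rw [opA_apply, opDA_apply]
  nlinarith [mul_nonneg (Nat.cast_nonneg (α := ℝ) n) h2]

/-- Positivity is inherited from `A` through `A ≤ (n + 1) D_A`. -/
lemma symmPosDef_opDA : SymmPosDef P.opDA := by
  refine ⟨fun x y => by rw [opDA_apply, opDA_apply, fluxFormD_comm, mortarForm_comm],
    fun r hr => ?_⟩
  have h := (P.opA_pos hr).trans_le (P.opA_le r)
  exact pos_of_mul_pos_right h (by positivity)

/-- The summand `1` in the lower constant absorbs the mortar term common to both forms, and keeps
the constant positive for all real `σ` and `κ`. -/
lemma spectrallyEquivalent {σ κ : ℝ} (hσ : G.ShapeRegular σ) (hκ : P.AnisotropyLE κ) :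
    P.SpectrallyEquivalent (1 + (n + 1) * (κ ^ 2 * σ ^ 2 * (4 * 8 ^ n)))⁻¹ (n + 1) := by
  refine fun r => ⟨?_, P.opA_le r⟩
  rw [inv_mul_le_iff₀ (by positivity), opA_apply, opDA_apply]
  have h1 := P.fluxFormD_le hσ hκ (G.total r)
  have h2 := P.fluxForm_nonneg (G.total r)
  have h3 := P.mortarForm_nonneg r.2
  have h4 : 0 ≤ (n + 1 : ℝ) * (κ ^ 2 * σ ^ 2 * (4 * 8 ^ n)) := by positivity
  nlinarith [mul_nonneg h4 h3]

end Params

end MixedDim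

theorem mainTheorem6 (n : ℕ) :
    (∀ σ κ : ℝ, ∃ c₁ c₂ : ℝ, 0 < c₁ ∧ 0 < c₂ ∧
      ∀ (G : MixedDim.Mesh n) (P : MixedDim.Params G), G.ShapeRegular σ → P.AnisotropyLE κ →
        P.SpectrallyEquivalent c₁ c₂ ∧
        P.FOVBounds (1 / 2 * min 1 c₂⁻¹) (max 2 (2 * c₁⁻¹))) ∧
    (∀ (G : MixedDim.Mesh n) (P : MixedDim.Params G), P.WellDefined ∧
      ∀ c₁ c₂ : ℝ, 0 < c₁ → 0 < c₂ → P.SpectrallyEquivalent c₁ c₂ →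
        P.FOVBounds (1 / 2 * min 1 c₂⁻¹) (max 2 (2 * c₁⁻¹))) := by
  have hfov : ∀ (G : MixedDim.Mesh n) (P : MixedDim.Params G) (c₁ c₂ : ℝ), 0 < c₁ → 0 < c₂ →
      P.SpectrallyEquivalent c₁ c₂ →
        P.FOVBounds (1 / 2 * min 1 c₂⁻¹) (max 2 (2 * c₁⁻¹)) := fun G P c₁ c₂ h₁ h₂ h =>
    P.fovBounds_of_spectrallyEquivalent P.symmPosDef_opA P.symmPosDef_opDA
      (fun _ => MixedDim.Mesh.opBT_injective) h₁ h₂ h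
  refine ⟨fun σ κ => ?_, fun G P => ⟨?_, hfov G P⟩⟩
  · have h₁ : 0 < (1 + (n + 1) * (κ ^ 2 * σ ^ 2 * (4 * 8 ^ n)))⁻¹ := by positivity
    have h₂ : 0 < (n + 1 : ℝ) := by positivity
    exact ⟨_, _, h₁, h₂, fun G P hσ hκ =>
      ⟨P.spectrallyEquivalent hσ hκ, hfov G P _ _ h₁ h₂ (P.spectrallyEquivalent hσ hκ)⟩⟩
  · exact P.wellDefined_of_symmPosDef P.symmPosDef_opA P.symmPosDef_opDA
      (fun _ => MixedDim.Mesh.opBT_injective)
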